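/- For $T\subset\mathbb R$ let $\mathcal P(T)$ be the set of probability measures on $T$ with moments $m_k(\nu)=\int x^k\,d\nu$ of all orders, and let $\mathcal M_N([0,\infty))=\{\vec m_N(\nu)=(m_1(\nu),\dots,m_N(\nu)):\nu\in\mathcal P([0,\infty))\}$ be the $N$-th moment space. For $\vec m=(m_1,\dots,m_N)$ put $m_0=1$, $m_0^-=0$, let $m_k^-$ be the least $k$-th moment of a measure in $\mathcal P([0,\infty))$ whose first $k-1$ moments are $m_1,\dots,m_{k-1}$, and let $z_k=\dfrac{m_k-m_k^-}{m_{k-1}-m_{k-1}^-}$ for $1\le k\le N$. For real parameters $\gamma_k,\delta_k$ with $\delta_k>0$ and $\gamma_k+N-k+1>0$ let $$g_N^{(\gamma,\delta)}(\vec m)=\prod_{k=1}^N\frac{\delta_k^{\gamma_k+N-k+1}}{\Gamma(\gamma_k+N-k+1)}\,\prod_{k=1}^N z_k^{\gamma_k}e^{-\delta_k z_k}\,\mathbf 1_{\{m_k>m_k^-\}}$$ (the function is $0$ as soon as one of the inequalities $m_k>m_k^-$ fails). For $n\ge1$, $\beta>0$ and $\gamma_0>-1$, the Laguerre $\beta$-ensemble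 spectral measure distribution $L\beta E_n(\gamma_0)$ is the law of the random probability measure $\sum_{i=1}^n w_i\delta_{\lambda_i}$, where $\lambda=(\lambda_1,\dots,\lambda_n)$ and $w=(w_1,\dots,w_n)$ are independent, $\lambda$ has Lebesgue density proportional to $\prod_{i<j}|\lambda_j-\lambda_i|^{\beta}\prod_{i=1}^n\lambda_i^{\gamma_0}e^{-\lambda_i}\mathbf 1_{\{\lambda_i>0\}}$, and $w$ has the Dirichlet density $\frac{\Gamma(n\beta/2)}{\Gamma(\beta/2)^n}\prod_{i=1}^n w_i^{\beta/2-1}$ on the simplex $\{w_i>0,\ \sum_i w_i=1\}$ (with respect to Lebesgue measure $dw_1\cdots dw_{n-1}$). **Theorem.** Let $n\ge 1$, $\beta>0$, $\gamma_0>-1$ and let $\mu\sim L\beta E_n(\gamma_0)$. Then almost surely $\mu\in\mathcal P([0,\infty))$, so that $\vec m_{2n-1}(\mu)\in\mathcal M_{2n-1}([0,\infty))$, and the distribution of the random moment vector $\vec m_{2n-1}(\mu)$ is absolutely continuous with respect to Lebesgue measure on $\mathbb R^{2n-1}$, with density $g_{2n-1}^{(\gamma,\delta)}$, where $\delta_k=1$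 for $1\le k\le 2n-1$ and $$\gamma_{2k-1}=\bigl(\tfrac{\beta}{2}-2\bigr)(n-k)+\gamma_0\quad(1\le k\le n),\qquad \gamma_{2k}=\bigl(\tfrac{\beta}{2}-2\bigr)(n-k)\quad(1\le k\le n-1).$$ -/

import Mathlib

open MeasureTheory ProbabilityTheory

noncomputable section

/-- The set of all probability measures on `T` (as measures on `ℝ` that give no mass to the
complement of `T`) with existing moments of all orders. -/
def probMoments (T : Set ℝ) : Set (Measure ℝ) :=
  {ν | IsProbabilityMeasure ν ∧ ν Tᶜ = 0 ∧ ∀ k : ℕ, Integrable (fun x : ℝ => x ^ k) ν}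

/-- The `k`-th moment of a measure on the real line. -/
def mom (ν : Measure ℝ) (k : ℕ) : ℝ := ∫ x, x ^ k ∂ν

/-- The vector `(m_1(ν), …, m_N(ν))`; the coordinate with index `i : Fin N` is `m_{i+1}(ν)`. -/
def momVec (N : ℕ) (ν : Measure ℝ) : Fin N → ℝ := fun i => mom ν (i + 1)

/-- The `N`-th moment space of `T`. -/
def momentSpace (N : ℕ) (T : Set ℝ) : Set (Fin N → ℝ) := momVec N '' probMoments T

/-- The entry `m_k` of a vector `(m_1, …, m_N)`, numbered from one, with `m_0 = 1`. -/
def entry {N : ℕ} (m : Fin N → ℝ) (k : ℕ) : ℝ :=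
  if k = 0 then 1 else if h : k - 1 < N then m ⟨k - 1, h⟩ else 0

/-- The lower bound `m_k^-` on the half line: the least `k`-th moment of a probability measure on
`[0, ∞)` with the moments `m_1, …, m_{k-1}`; and `m_0^- = 0`. -/
def lowerMom {N : ℕ} (m : Fin N → ℝ) (k : ℕ) : ℝ :=
  if k = 0 then 0
  else sInf {x : ℝ | ∃ ν ∈ probMoments (Set.Ici 0),
    (∀ i ∈ Finset.Icc 1 (k - 1), mom ν i = entry m i) ∧ x = mom ν k}

/-- The quantities `z_k = (m_k - m_k^-) / (m_{k-1} - m_{k-1}^-)`. -/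
def zCoord {N : ℕ} (m : Fin N → ℝ) (k : ℕ) : ℝ :=
  (entry m k - lowerMom m k) / (entry m (k - 1) - lowerMom m (k - 1))

open Classical in
/-- The density `g_N^{(γ,δ)}` on the moment space of `[0, ∞)`. -/
def halfLineDensity (N : ℕ) (γ δ : ℕ → ℝ) (m : Fin N → ℝ) : ℝ :=
  (∏ k ∈ Finset.Icc 1 N,
    δ k ^ (γ k + (N : ℝ) - (k : ℝ) + 1) / Real.Gamma (γ k + (N : ℝ) - (k : ℝ) + 1)) *
  ∏ k ∈ Finset.Icc 1 N,
    (zCoord m k ^ γ k * Real.exp (-(δ k * zCoord m k)) *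
      if lowerMom m k < entry m k then 1 else 0)

open Classical in
/-- The function `|Δ(x)|^β ∏ x_i^a e^{-x_i} 1{x_i > 0}`. -/
def laguerreWeight (n : ℕ) (β a : ℝ) (x : Fin n → ℝ) : ℝ :=
  |∏ i : Fin n, ∏ j ∈ Finset.Ioi i, (x j - x i)| ^ β *
    ∏ i : Fin n, (x i ^ a * Real.exp (-x i) * if 0 < x i then 1 else 0)

/-- The law on `ℝ^n` of the support points: its Lebesgue density is the normalized
`laguerreWeight`. -/
def laguerreEigenLaw (n : ℕ) (β a : ℝ) : Measure (Fin n → ℝ) :=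
  volume.withDensity fun x =>
    ENNReal.ofReal ((∫ y, laguerreWeight n β a y)⁻¹ * laguerreWeight n β a x)

/-- `(w_1, …, w_{n-1}) ↦ (w_1, …, w_{n-1}, 1 - w_1 - ⋯ - w_{n-1})`. -/
def completeWeights (n : ℕ) (p : Fin (n - 1) → ℝ) : Fin n → ℝ := fun i =>
  if h : (i : ℕ) < n - 1 then p ⟨i, h⟩ else 1 - ∑ j, p j

/-- The open simplex. -/
def simplex (n : ℕ) : Set (Fin n → ℝ) := {w | (∀ i, 0 < w i) ∧ ∑ i, w i = 1}

open Classical in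
/-- The Dirichlet density of the weights, with all parameters equal to `β / 2`. -/
def dirichletDensity (n : ℕ) (β : ℝ) (w : Fin n → ℝ) : ℝ :=
  Real.Gamma ((n : ℝ) * β / 2) / Real.Gamma (β / 2) ^ n * (∏ i, w i ^ (β / 2 - 1)) *
    if w ∈ simplex n then 1 else 0

/-- The Dirichlet law of `(w_1, …, w_n)`; the density is with respect to Lebesgue measure in the
free coordinates `w_1, …, w_{n-1}`. -/
def dirichletLaw (n : ℕ) (β : ℝ) : Measure (Fin n → ℝ) :=
  (volume.withDensity fun p : Fin (n - 1) → ℝ =>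
    ENNReal.ofReal (dirichletDensity n β (completeWeights n p))).map (completeWeights n)

/-- The measure `∑ w_i δ_{x_i}`, for support points `x` and weights `w`. -/
def atomicMeasure (n : ℕ) (q : (Fin n → ℝ) × (Fin n → ℝ)) : Measure ℝ :=
  ∑ i, ENNReal.ofReal (q.2 i) • Measure.dirac (q.1 i)

/-- The distribution `LβE_n(a)` on measures: the law of `∑ w_i δ_{λ_i}` with independent support
points and weights. -/
def laguerreSpectralLaw (n : ℕ) (β a : ℝ) : Measure (Measure ℝ) :=
  ((laguerreEigenLaw n β a).prod (dirichletLaw n β)).map (atomicMeasure n)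

theorem measurable_completeWeights (n : ℕ) : Measurable (completeWeights n) := by
  refine measurable_pi_lambda _ fun i => ?_
  unfold completeWeights
  split_ifs <;> fun_prop

theorem measurable_atomicMeasure (n : ℕ) : Measurable (atomicMeasure n) := by
  refine Measure.measurable_of_measurable_coe _ fun s hs => ?_
  simp only [atomicMeasure, Measure.coe_finsetSum, Finset.sum_apply, Measure.smul_apply,
    smul_eq_mul]
  refine Finset.measurable_sum _ fun i _ => Measurable.mul (by fun_prop) ?_
  exact (Measure.measurable_coe hs).comp (Measure.measurable_dirac.comp (by fun_prop))

end

/-! The moment map is computed in two coordinate systems, the canonical coordinates z and the nodes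
and weights, and the two Jacobians are compared.

In canonical coordinates, Stieltjes' path expansion writes m_k as the total weight of Dyck paths of
length 2k whose down step from j+1 to j has weight a_j = z_{j+1}. Exactly one such path reaches
height k, so m_k is a function of z_1, …, z_{k-1} plus z_1⋯z_k. The first part is m_k^-
(`lowerMom_succ_eq`): it is attained by a Gauss quadrature, and a monic polynomial of degree k,
nonnegative on the half line and zero at the quadrature nodes, shows that nothing smaller occurs.
Hence z ↦ m maps the positive orthant bijectively onto the region m_k > m_k^-, with triangular
Jacobian ∏ z_k^{N-k} (`det_fderiv_momOfRec`).

For n nodes λ and weights w, the Jacobian of the first 2n-1 moments is a confluent Vandermonde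
determinant, of absolute value ∏w_i · |Δ(λ)|^4 (`det_nodeMomDeriv`). For each ordering of the nodes
the moment map is a bijection onto the same region (`image_nodeMom`).

The link is the Jacobi matrix J = BBᵀ with B bidiagonal in the √a_j (`exists_quadrature`). Its
trace, its determinant and its Krylov matrix give ∑λ_i = ∑z_k, ∏λ_i = z_1 z_3 ⋯ z_{2n-1}, and a
formula for ∏w_i · Δ(λ)^2 as a monomial in z. The joint density then splits by |Δ|^β ∏w_i^{β/2-1} =
(∏w_i |Δ|^4) · (∏w_i Δ^2)^{β/2-2}: the first factor is the Jacobian and the second yields the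
exponents γ_k (`weight_chamber_eq`).

Summing over orderings contributes n!. The eigenvalue normalization follows from the same identity:
the Dirichlet density has mass one, and in z-coordinates the total integral is a product of Gamma
integrals (`lintegral_recWeight`), so Selberg's integral need not be known beforehand. -/

/-! ### Weighted path counts -/

/-- `dyck a l h` is the total weight of the nonnegative lattice paths of length `l` from height `0`
to height `h`, where an up step has weight `1` and a down step from `j + 1` to `j` has
weight `a j`. -/
def dyck (a : ℕ → ℝ) : ℕ → ℕ → ℝ
  | 0, 0 => 1
  | 0, _ + 1 => 0
  | l + 1, 0 => a 0 * dyck a l 1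
  | l + 1, h + 1 => dyck a l h + a (h + 1) * dyck a l (h + 2)

/-- The sequence `a` with all entries from index `k` on replaced by zero. -/
def truncSeq (k : ℕ) (a : ℕ → ℝ) : ℕ → ℝ := fun j => if j < k then a j else 0

theorem dyck_eq_zero (a : ℕ → ℝ) {l h : ℕ} (hl : l < h) : dyck a l h = 0 := by
  induction l generalizing h with
  | zero => obtain ⟨h, rfl⟩ : ∃ h', h = h' + 1 := ⟨h - 1, by omega⟩; rfl
  | succ l ih =>
    obtain ⟨h, rfl⟩ : ∃ h', h = h' + 1 := ⟨h - 1, by omega⟩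
    rw [dyck, ih (by omega), ih (by omega)]; simp

theorem dyck_self (a : ℕ → ℝ) (l : ℕ) : dyck a l l = 1 := by
  induction l with
  | zero => rfl
  | succ l ih => rw [dyck, ih, dyck_eq_zero a (by omega)]; simp

/-- A path of length l ending at h climbs to height at most (l + h)/2, and the weight `a j` is used
only by paths that visit height j + 1. -/
theorem dyck_congr {a b : ℕ → ℝ} {l h : ℕ} (hab : ∀ j, 2 * j + 2 ≤ l + h → a j = b j) :
    dyck a l h = dyck b l h := by
  induction l generalizing h with
  | zero => cases h <;> rfl
  | succ l ih =>
    cases h with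
    | zero =>
      rcases Nat.eq_zero_or_pos l with rfl | hl
      · simp [dyck]
      rw [dyck, dyck, ih fun j hj => hab j (by omega), hab 0 (by omega)]
    | succ h =>
      rw [dyck, dyck, ih fun j hj => hab j (by omega)]
      by_cases hlt : l < h + 2
      · rw [dyck_eq_zero a hlt, dyck_eq_zero b hlt]; simp
      · rw [ih fun j hj => hab j (by omega), hab (h + 1) (by omega)]

/-- The maximal height h + d + 1 is reached only by the path that makes all its up steps first; its
descent contributes the product. Killing the weights from h + d on removes this path and no other.
-/
theorem dyck_truncSeq (a : ℕ → ℝ) {l h d : ℕ} (hd : l = h + 2 * (d + 1)) :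
    dyck a l h = dyck (truncSeq (h + d) a) l h + ∏ j ∈ Finset.range (d + 1), a (h + j) := by
  induction l generalizing h d with
  | zero => omega
  | succ l ih =>
    have step : ∀ h d, l + 1 = h + 2 * (d + 1) → a h * dyck a l (h + 1)
        = truncSeq (h + d) a h * dyck (truncSeq (h + d) a) l (h + 1)
          + ∏ j ∈ Finset.range (d + 1), a (h + j) := by
      intro h d hd
      cases d with
      | zero =>
        obtain rfl : l = h + 1 := by omega
        simp [truncSeq, dyck_self]
      | succ d =>
        rw [ih (h := h + 1) (d := d) (by omega), Finset.prod_range_succ' _ (d + 1)]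
        have e1 : truncSeq (h + (d + 1)) a h = a h := by simp [truncSeq]
        rw [e1, show h + (d + 1) = h + 1 + d by ring, mul_add, add_zero]
        congr 1
        rw [mul_comm]
        congr 1
        exact Finset.prod_congr rfl fun j _ => by congr 1; ring
    cases h with
    | zero => rw [dyck, dyck]; exact step 0 d hd
    | succ h =>
      rw [dyck, dyck, step (h + 1) d hd, ← add_assoc]
      congr 2
      -- The term for a final up step comes from paths ending one level lower, which are too short
      -- to use any weight removed by the truncation.
      refine dyck_congr fun j hj => ?_
      rw [truncSeq, if_pos (by omega)]

/-- The moments depend on the last recursion coefficient in an affine way. -/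
theorem dyck_even_eq (a : ℕ → ℝ) (k : ℕ) :
    dyck a (2 * (k + 1)) 0 =
      dyck (truncSeq k a) (2 * (k + 1)) 0 + ∏ j ∈ Finset.range (k + 1), a j := by
  have := dyck_truncSeq a (l := 2 * (k + 1)) (h := 0) (d := k) (by ring)
  simpa using this

theorem truncSeq_nonneg {a : ℕ → ℝ} {k : ℕ} (ha : ∀ j < k, 0 ≤ a j) (j : ℕ) :
    0 ≤ truncSeq k a j := by
  unfold truncSeq; split_ifs with h
  · exact ha j h
  · exact le_rfl

/-! ### Quadrature formulas from Jacobi matrices -/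

/-- The lower bidiagonal factor of the Jacobi matrix with recursion coefficients `a`. -/
noncomputable def bidiag (n : ℕ) (a : ℕ → ℝ) : Matrix (Fin n) (Fin n) ℝ := Matrix.of fun i j =>
  if j = i then √(a (2 * i)) else if (j : ℕ) + 1 = i then √(a (2 * j + 1)) else 0

/-- The symmetrized path counts. -/
noncomputable def symDyck (a : ℕ → ℝ) (l h : ℕ) : ℝ := dyck a l h * ∏ j ∈ Finset.range h, √(a j)

theorem symDyck_succ_zero {a : ℕ → ℝ} (ha : ∀ j, 0 ≤ a j) (l : ℕ) :
    symDyck a (l + 1) 0 = √(a 0) * symDyck a l 1 := by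
  have := Real.mul_self_sqrt (ha 0)
  simp only [symDyck, dyck, Finset.prod_range_succ, Finset.prod_range_zero]
  linear_combination (-dyck a l 1) * this

theorem symDyck_succ_succ {a : ℕ → ℝ} (ha : ∀ j, 0 ≤ a j) (l h : ℕ) :
    symDyck a (l + 1) (h + 1) =
      √(a h) * symDyck a l h + √(a (h + 1)) * symDyck a l (h + 2) := by
  have := Real.mul_self_sqrt (ha (h + 1))
  simp only [symDyck, dyck, Finset.prod_range_succ]
  linear_combination (-dyck a l (h + 2) * (∏ j ∈ Finset.range h, √(a j)) * √(a h)) * this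

/-- The path matrix is bipartite: one step exchanges even and odd heights, so `bidiag` carries odd
heights to even ones and its transpose goes back. The vanishing of `a (2 * r + 1)` closes the chain
at height 2r + 1, which matters only for the last coordinate. -/
theorem bidiag_transpose_mulVec {a : ℕ → ℝ} (ha : ∀ j, 0 ≤ a j) {r : ℕ} (hz : a (2 * r + 1) = 0)
    (k : ℕ) : (bidiag (r + 1) a).transpose.mulVec (fun i => symDyck a (2 * k) (2 * i)) =
      fun i : Fin (r + 1) => symDyck a (2 * k + 1) (2 * i + 1) := by
  funext i
  rw [symDyck_succ_succ ha]
  simp only [Matrix.mulVec, dotProduct, Matrix.transpose_apply, bidiag, Matrix.of_apply]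
  have hsplit : ∀ x : Fin (r + 1), (if i = x then √(a (2 * x)) else
      if (i : ℕ) + 1 = x then √(a (2 * i + 1)) else 0) * symDyck a (2 * k) (2 * x) =
      (if i = x then √(a (2 * x)) * symDyck a (2 * k) (2 * x) else 0) +
      if (i : ℕ) + 1 = x then √(a (2 * i + 1)) * symDyck a (2 * k) (2 * x) else 0 := by
    intro x
    by_cases h1 : i = x
    · subst h1; simp
    · simp [h1, ite_mul]
  rw [Finset.sum_congr rfl fun x _ => hsplit x, Finset.sum_add_distrib, Finset.sum_ite_eq]
  simp only [Finset.mem_univ, if_true]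
  congr 1
  by_cases hi : (i : ℕ) + 1 < r + 1
  · rw [Finset.sum_eq_single (⟨i + 1, hi⟩ : Fin (r + 1))]
    · simp [mul_add]
    · intro b _ hb
      rw [if_neg]
      intro h; exact hb (Fin.ext h.symm)
    · simp
  · have : (i : ℕ) = r := by omega
    rw [Finset.sum_eq_zero, this, hz]
    · simp
    · intro x _
      rw [if_neg]; omega

theorem bidiag_mulVec {a : ℕ → ℝ} (ha : ∀ j, 0 ≤ a j) (n : ℕ) (k : ℕ) :
    (bidiag n a).mulVec (fun i => symDyck a (2 * k + 1) (2 * i + 1)) =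
      fun i : Fin n => symDyck a (2 * (k + 1)) (2 * i) := by
  funext i
  simp only [Matrix.mulVec, dotProduct, bidiag, Matrix.of_apply]
  have hsplit : ∀ x : Fin n, (if x = i then √(a (2 * i)) else
      if (x : ℕ) + 1 = i then √(a (2 * x + 1)) else 0) * symDyck a (2 * k + 1) (2 * x + 1) =
      (if x = i then √(a (2 * x)) * symDyck a (2 * k + 1) (2 * x + 1) else 0) +
      if (x : ℕ) + 1 = i then √(a (2 * x + 1)) * symDyck a (2 * k + 1) (2 * x + 1) else 0 := by
    intro x
    by_cases h1 : x = i
    · subst h1; simp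
    · simp [h1, ite_mul]
  rw [Finset.sum_congr rfl fun x _ => hsplit x, Finset.sum_add_distrib, Finset.sum_ite_eq']
  simp only [Finset.mem_univ, if_true]
  rw [show 2 * (k + 1) = 2 * k + 1 + 1 by ring]
  obtain ⟨i, hi⟩ := i
  cases i with
  | zero => simp [symDyck_succ_zero ha]
  | succ i =>
    rw [Finset.sum_eq_single (⟨i, by omega⟩ : Fin n)]
    · simp only [if_true]
      rw [show 2 * (i + 1) = 2 * i + 1 + 1 by ring, symDyck_succ_succ ha (2 * k + 1)]
      ring
    · intro b _ hb
      rw [if_neg]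
      intro h; exact hb (Fin.ext (by simpa using h))
    · simp

theorem det_bidiag_sq {a : ℕ → ℝ} (ha : ∀ j, 0 ≤ a j) (n : ℕ) :
    (bidiag n a).det ^ 2 = ∏ i ∈ Finset.range n, a (2 * i) := by
  rw [Matrix.det_of_isLowerTriangular, ← Finset.prod_pow, ← Fin.prod_univ_eq_prod_range]
  · exact Finset.prod_congr rfl fun i _ => by simp [bidiag, Real.sq_sqrt (ha _)]
  · intro i j hij
    have : i < j := hij
    have h2 : (i : ℕ) < j := this
    simp only [bidiag, Matrix.of_apply]
    rw [if_neg (by omega), if_neg (by omega)]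

theorem trace_bidiag {a : ℕ → ℝ} (ha : ∀ j, 0 ≤ a j) (r : ℕ) :
    (bidiag (r + 1) a * (bidiag (r + 1) a).transpose).trace =
      ∑ j ∈ Finset.range (2 * r + 1), a j := by
  have hsplit : ∀ i x : Fin (r + 1), (bidiag (r + 1) a) i x * (bidiag (r + 1) a) i x =
      (if x = i then a (2 * x) else 0) + if (x : ℕ) + 1 = i then a (2 * x + 1) else 0 := by
    intro i x
    simp only [bidiag, Matrix.of_apply]
    by_cases h1 : x = i
    · subst h1; simp [Real.mul_self_sqrt (ha _)]
    · by_cases h2 : (x : ℕ) + 1 = i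
      · simp [h1, h2, Real.mul_self_sqrt (ha _)]
      · simp [h1, h2]
  simp only [Matrix.trace, Matrix.diag, Matrix.mul_apply, Matrix.transpose_apply, hsplit,
    Finset.sum_add_distrib, Finset.sum_ite_eq', Finset.mem_univ, if_true]
  rw [Finset.sum_comm (f := fun i x : Fin (r + 1) => if (x : ℕ) + 1 = i then a (2 * x + 1) else 0)]
  rw [Fin.sum_univ_castSucc (f := fun y : Fin (r + 1) =>
    ∑ x : Fin (r + 1), if (y : ℕ) + 1 = x then a (2 * y + 1) else 0)]
  have h1 : ∀ y : Fin r, (∑ x : Fin (r + 1), if ((y.castSucc : Fin (r + 1)) : ℕ) + 1 = x then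
      a (2 * ((y.castSucc : Fin (r + 1)) : ℕ) + 1) else 0) = a (2 * y + 1) := by
    intro y
    rw [Finset.sum_eq_single y.succ]
    · simp
    · intro b _ hb
      rw [if_neg]
      intro h; exact hb (Fin.ext (by simpa using h.symm))
    · simp
  have h2 : (∑ x : Fin (r + 1), if ((Fin.last r : Fin (r + 1)) : ℕ) + 1 = x then
      a (2 * ((Fin.last r : Fin (r + 1)) : ℕ) + 1) else 0) = 0 := by
    refine Finset.sum_eq_zero fun x _ => ?_
    rw [if_neg]
    simp only [Fin.val_last]; omega
  rw [h2, add_zero, Finset.sum_congr rfl fun y _ => h1 y,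
    Fin.sum_univ_eq_sum_range (fun i => a (2 * i)), Fin.sum_univ_eq_sum_range (fun i => a (2 * i + 1))]
  clear hsplit h1 h2
  induction r with
  | zero => simp
  | succ r ih =>
    rw [show 2 * (r + 1) + 1 = 2 * r + 1 + 1 + 1 by ring, Finset.sum_range_succ _ (2 * r + 1 + 1),
      Finset.sum_range_succ _ (2 * r + 1), ← ih, Finset.sum_range_succ _ (r + 1),
      Finset.sum_range_succ (fun i => a (2 * i + 1)), show 2 * (r + 1) = 2 * r + 1 + 1 by ring]
    ring

theorem exists_orthogonal_diagonalization {n : ℕ} {A : Matrix (Fin n) (Fin n) ℝ}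
    (hA : A.PosSemidef) : ∃ (U : Matrix (Fin n) (Fin n) ℝ) (x : Fin n → ℝ), (∀ i, 0 ≤ x i) ∧
      U.transpose * U = 1 ∧ U * U.transpose = 1 ∧ A = U * Matrix.diagonal x * U.transpose := by
  have hU := hA.1.eigenvectorUnitary.2
  rw [Matrix.mem_unitaryGroup_iff, Matrix.star_eq_conjTranspose,
    Matrix.conjTranspose_eq_transpose_of_trivial] at hU
  refine ⟨hA.1.eigenvectorUnitary, hA.1.eigenvalues, hA.eigenvalues_nonneg,
    mul_eq_one_comm.mp hU, hU, ?_⟩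
  have := hA.1.spectral_theorem
  rw [Unitary.conjStarAlgAut_apply] at this
  conv_lhs => rw [this]
  rw [Matrix.star_eq_conjTranspose,
    Matrix.conjTranspose_eq_transpose_of_trivial]
  rfl

/-- A Gauss quadrature: nodes and weights on the half line realizing the moments encoded by the
recursion coefficients `a`, together with the symmetric functions of nodes and weights. -/
theorem exists_quadrature (r : ℕ) {a : ℕ → ℝ} (ha : ∀ j, 0 ≤ a j) (hz : a (2 * r + 1) = 0) :
    ∃ x w : Fin (r + 1) → ℝ, (∀ i, 0 ≤ x i) ∧ (∀ i, 0 ≤ w i) ∧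
      (∀ k, ∑ i, w i * x i ^ k = dyck a (2 * k) 0) ∧
      ∑ i, x i = ∑ j ∈ Finset.range (2 * r + 1), a j ∧
      ∏ i, x i = ∏ i ∈ Finset.range (r + 1), a (2 * i) ∧
      (∏ i, w i) * (Matrix.vandermonde x).det ^ 2 =
        ∏ k ∈ Finset.range (r + 1), ∏ j ∈ Finset.range (2 * k), a j := by
  set J := bidiag (r + 1) a * (bidiag (r + 1) a).transpose with hJ
  have hpsd : J.PosSemidef := by
    have := Matrix.posSemidef_self_mul_conjTranspose (bidiag (r + 1) a)
    rwa [Matrix.conjTranspose_eq_transpose_of_trivial] at this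
  obtain ⟨U, x, hx, hU1, hU2, hJU⟩ := exists_orthogonal_diagonalization hpsd
  have hv : ∀ k, J.mulVec (fun i => symDyck a (2 * k) (2 * i)) =
      fun i : Fin (r + 1) => symDyck a (2 * (k + 1)) (2 * i) := by
    intro k
    rw [hJ, ← Matrix.mulVec_mulVec, bidiag_transpose_mulVec ha hz, bidiag_mulVec ha]
  -- The vector on the left is J^k e_0 in the eigenbasis; e_0 has the coordinates `U 0 i`, whose
  -- squares become the weights.
  have hy : ∀ k, U.transpose.mulVec (fun i : Fin (r + 1) => symDyck a (2 * k) (2 * i)) =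
      fun i => U 0 i * x i ^ k := by
    intro k
    induction k with
    | zero =>
      funext i
      simp only [Matrix.mulVec, dotProduct, Matrix.transpose_apply]
      rw [Finset.sum_eq_single 0]
      · simp [symDyck, dyck]
      · intro b _ hb
        have : 0 < (b : ℕ) := Nat.pos_of_ne_zero fun h => hb (Fin.ext h)
        simp [symDyck, dyck_eq_zero a (show 0 < 2 * (b : ℕ) by omega)]
      · simp
    | succ k ih =>
      rw [← hv, hJU, ← Matrix.mulVec_mulVec, ← Matrix.mulVec_mulVec, ih, Matrix.mulVec_mulVec,
        hU1, Matrix.one_mulVec]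
      funext i
      rw [Matrix.mulVec_diagonal]; ring
  have hdetU : U.det ^ 2 = 1 := by
    have := congrArg Matrix.det hU1
    rwa [Matrix.det_mul, Matrix.det_transpose, Matrix.det_one, ← sq] at this
  refine ⟨x, fun i => U 0 i ^ 2, hx, fun i => sq_nonneg _, ?_, ?_, ?_, ?_⟩
  · intro k
    have h1 : U.mulVec (fun i => U 0 i * x i ^ k) =
        fun i : Fin (r + 1) => symDyck a (2 * k) (2 * i) := by
      rw [← hy, Matrix.mulVec_mulVec, hU2, Matrix.one_mulVec]
    have h2 := congrFun h1 0
    simp only [Matrix.mulVec, dotProduct] at h2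
    simp only [symDyck, Fin.val_zero, mul_zero, Finset.range_zero, Finset.prod_empty,
      mul_one] at h2
    rw [← h2]
    exact Finset.sum_congr rfl fun i _ => by ring
  · rw [← trace_bidiag ha, ← hJ, hJU, Matrix.trace_mul_comm, ← mul_assoc, hU1, one_mul,
      Matrix.trace_diagonal]
  · rw [← det_bidiag_sq ha, sq]
    nth_rewrite 2 [← Matrix.det_transpose]
    rw [← Matrix.det_mul, ← hJ, hJU, Matrix.det_mul, Matrix.det_mul, Matrix.det_transpose,
      Matrix.det_diagonal]
    linear_combination (-∏ i, x i) * hdetU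
  -- K is the Krylov matrix with columns J^k e_0. It is upper triangular because 2k steps cannot
  -- climb above height 2k. In the eigenbasis it factors as a diagonal matrix times a Vandermonde
  -- matrix, so comparing squared determinants gives the identity.
  · set K : Matrix (Fin (r + 1)) (Fin (r + 1)) ℝ :=
      Matrix.of fun i k => symDyck a (2 * k) (2 * i) with hK
    have h1 : U.transpose * K = Matrix.diagonal (fun i => U 0 i) * Matrix.vandermonde x := by
      ext i k
      rw [Matrix.diagonal_mul, Matrix.vandermonde_apply]
      exact congrFun (hy k) i
    have h2 : K.det ^ 2 = ∏ k ∈ Finset.range (r + 1), ∏ j ∈ Finset.range (2 * k), a j := by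
      rw [Matrix.det_of_isUpperTriangular, ← Finset.prod_pow, ← Fin.prod_univ_eq_prod_range]
      · refine Finset.prod_congr rfl fun i _ => ?_
        simp only [hK, Matrix.of_apply, symDyck, dyck_self, one_mul]
        rw [← Finset.prod_pow]
        exact Finset.prod_congr rfl fun j _ => Real.sq_sqrt (ha j)
      · intro i j hij
        have h2 : (j : ℕ) < i := hij
        simp [hK, symDyck, dyck_eq_zero a (show 2 * (j : ℕ) < 2 * i by omega)]
    have h3 := congrArg (fun M => Matrix.det M ^ 2) h1
    simp only [Matrix.det_mul, Matrix.det_transpose, mul_pow, hdetU, one_mul,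
      Matrix.det_diagonal] at h3
    rw [← h2, h3, Finset.prod_pow]

/-! ### Finitely supported measures and test polynomials -/

theorem integral_atomicMeasure {n : ℕ} (x : Fin n → ℝ) {w : Fin n → ℝ} (hw : ∀ i, 0 ≤ w i)
    (f : ℝ → ℝ) : ∫ y, f y ∂(atomicMeasure n (x, w)) = ∑ i, w i * f (x i) := by
  unfold atomicMeasure
  rw [integral_finsetSum_measure]
  · exact Finset.sum_congr rfl fun i _ => by
      rw [integral_smul_measure, integral_dirac, ENNReal.toReal_ofReal (hw i), smul_eq_mul]
  · intro i _
    exact (integrable_dirac (by simp)).smul_measure ENNReal.ofReal_ne_top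

theorem integrable_atomicMeasure {n : ℕ} (q : (Fin n → ℝ) × (Fin n → ℝ))
    (f : ℝ → ℝ) : Integrable f (atomicMeasure n q) := by
  unfold atomicMeasure
  rw [integrable_finsetSum_measure]
  intro i _
  exact (integrable_dirac (by simp)).smul_measure ENNReal.ofReal_ne_top

theorem mom_atomicMeasure {n : ℕ} (x : Fin n → ℝ) {w : Fin n → ℝ} (hw : ∀ i, 0 ≤ w i) (k : ℕ) :
    mom (atomicMeasure n (x, w)) k = ∑ i, w i * x i ^ k :=
  integral_atomicMeasure x hw _

theorem atomicMeasure_mem_probMoments {n : ℕ} {x w : Fin n → ℝ} (hx : ∀ i, 0 ≤ x i)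
    (hw : ∀ i, 0 ≤ w i) (hw1 : ∑ i, w i = 1) :
    atomicMeasure n (x, w) ∈ probMoments (Set.Ici 0) := by
  refine ⟨⟨?_⟩, ?_, fun k => integrable_atomicMeasure _ _⟩
  · simp only [atomicMeasure, Measure.coe_finsetSum, Finset.sum_apply, Measure.smul_apply,
      measure_univ, smul_eq_mul, mul_one]
    rw [← ENNReal.ofReal_sum_of_nonneg fun i _ => hw i, hw1, ENNReal.ofReal_one]
  · simp [atomicMeasure, Measure.dirac_apply' _ measurableSet_Iio, hx]

theorem mom_zero {ν : Measure ℝ} {T : Set ℝ} (hν : ν ∈ probMoments T) : mom ν 0 = 1 := by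
  have := hν.1
  simp [mom]

open Polynomial in
theorem integral_polynomial {ν : Measure ℝ} (hν : ∀ k : ℕ, Integrable (fun x : ℝ => x ^ k) ν)
    (q : ℝ[X]) {d : ℕ} (hd : q.natDegree < d) :
    ∫ y, q.eval y ∂ν = ∑ i ∈ Finset.range d, q.coeff i * mom ν i := by
  simp only [Polynomial.eval_eq_sum_range' hd, mom]
  rw [integral_finsetSum _ fun i _ => (hν i).const_mul _]
  exact Finset.sum_congr rfl fun i _ => integral_const_mul _ _

-- The polynomial has double zeros at the nodes. For even k the determinant of J contains the factor
-- `a k = 0`, so some node is 0; a single factor X suffices there, being nonnegative on the half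
-- line. In both parities the degree is k + 1.
open Polynomial in
theorem exists_nodes_testPolynomial (k : ℕ) {a : ℕ → ℝ} (ha : ∀ j, 0 ≤ a j)
    (hz : ∀ j, k ≤ j → a j = 0) :
    ∃ (n : ℕ) (x w : Fin n → ℝ) (q : ℝ[X]), (∀ i, 0 ≤ x i) ∧ (∀ i, 0 ≤ w i) ∧
      (∀ l, ∑ i, w i * x i ^ l = dyck a (2 * l) 0) ∧ q.Monic ∧ q.natDegree = k + 1 ∧
      (∀ i, q.eval (x i) = 0) ∧ (∀ y, 0 ≤ y → 0 ≤ q.eval y) ∧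
      ∃ s : Finset ℝ, s.card ≤ (k + 1) / 2 ∧ ∀ y, 0 < y → q.eval y = 0 → y ∈ s := by
  classical
  obtain ⟨r, rfl | rfl⟩ := k.even_or_odd'
  · obtain ⟨x, w, hx, hw, hmom, -, hprod, -⟩ := exists_quadrature r ha (hz _ (by omega))
    have h0 : ∏ i, x i = 0 := by
      rw [hprod]
      exact Finset.prod_eq_zero (Finset.mem_range.2 (Nat.lt_succ_self r)) (hz _ le_rfl)
    obtain ⟨i₀, -, hi₀⟩ := Finset.prod_eq_zero_iff.1 h0
    have hmon : (∏ i ∈ Finset.univ.erase i₀, (X - C (x i)) : ℝ[X]).Monic :=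
      monic_prod_of_monic _ _ fun i _ => monic_X_sub_C _
    have hcard : (Finset.univ.erase i₀).card = r := by simp
    refine ⟨r + 1, x, w, X * (∏ i ∈ Finset.univ.erase i₀, (X - C (x i))) ^ 2, hx, hw, hmom,
      monic_X.mul (hmon.pow 2), ?_, ?_, ?_, (Finset.univ.erase i₀).image x, ?_, ?_⟩
    · rw [(monic_X).natDegree_mul (hmon.pow 2), hmon.natDegree_pow, natDegree_X,
        natDegree_prod_of_monic _ _ fun i _ => monic_X_sub_C _]
      simp only [natDegree_X_sub_C, Finset.sum_const, hcard, smul_eq_mul]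
      ring
    · intro i
      by_cases hi : i = i₀
      · simp [hi, hi₀]
      · simp only [eval_mul, eval_pow, eval_prod, eval_sub, eval_X, eval_C]
        rw [Finset.prod_eq_zero (i := i) (by simp [hi]) (sub_self _)]
        simp
    · intro y hy
      simp only [eval_mul, eval_pow, eval_X]
      positivity
    · refine Finset.card_image_le.trans ?_
      rw [hcard]; omega
    · intro y hy h
      simp only [eval_mul, eval_pow, eval_X, mul_eq_zero, hy.ne', false_or, pow_eq_zero_iff,
        eval_prod, eval_sub, eval_C, ne_eq, OfNat.ofNat_ne_zero, not_false_eq_true,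
        Finset.prod_eq_zero_iff] at h
      obtain ⟨i, hi, h⟩ := h
      exact Finset.mem_image.2 ⟨i, hi, (sub_eq_zero.1 h).symm⟩
  · obtain ⟨x, w, hx, hw, hmom, -, -, -⟩ := exists_quadrature r ha (hz _ le_rfl)
    have hmon : (∏ i, (X - C (x i)) : ℝ[X]).Monic :=
      monic_prod_of_monic _ _ fun i _ => monic_X_sub_C _
    refine ⟨r + 1, x, w, (∏ i, (X - C (x i))) ^ 2, hx, hw, hmom,
      hmon.pow 2, ?_, ?_, ?_, Finset.univ.image x, ?_, ?_⟩
    · rw [hmon.natDegree_pow, natDegree_prod_of_monic _ _ fun i _ => monic_X_sub_C _]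
      simp only [natDegree_X_sub_C, Finset.sum_const, Finset.card_univ, Fintype.card_fin,
        smul_eq_mul]
      ring
    · intro i
      simp only [eval_pow, eval_prod, eval_sub, eval_X, eval_C]
      rw [Finset.prod_eq_zero (i := i) (by simp) (sub_self _)]
      simp
    · intro y hy
      simp only [eval_pow]
      positivity
    · refine Finset.card_image_le.trans ?_
      rw [Finset.card_univ, Fintype.card_fin]; omega
    · intro y hy h
      simp only [eval_pow, eval_X, pow_eq_zero_iff,
        eval_prod, eval_sub, eval_C, ne_eq, OfNat.ofNat_ne_zero, not_false_eq_true,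
        Finset.prod_eq_zero_iff] at h
      obtain ⟨i, hi, h⟩ := h
      exact Finset.mem_image.2 ⟨i, hi, (sub_eq_zero.1 h).symm⟩

open Polynomial in
/-- The gap between a moment and its lower bound is the integral of a nonnegative polynomial with
few positive zeros, and the lower bound is attained. -/
theorem exists_moment_gap (k : ℕ) {a : ℕ → ℝ} (ha : ∀ j, 0 ≤ a j) (hz : ∀ j, k ≤ j → a j = 0) :
    (∃ ν ∈ probMoments (Set.Ici 0), ∀ l, mom ν l = dyck a (2 * l) 0) ∧
    ∃ q : ℝ[X], (∀ y, 0 ≤ y → 0 ≤ q.eval y) ∧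
      (∃ s : Finset ℝ, s.card ≤ (k + 1) / 2 ∧ ∀ y, 0 < y → q.eval y = 0 → y ∈ s) ∧
      ∀ ν ∈ probMoments (Set.Ici 0), (∀ i ∈ Finset.Icc 1 k, mom ν i = dyck a (2 * i) 0) →
        mom ν (k + 1) = dyck a (2 * (k + 1)) 0 + ∫ y, q.eval y ∂ν := by
  obtain ⟨n, x, w, q, hx, hw, hmom, hmon, hdeg, hroot, hpos, hs⟩ :=
    exists_nodes_testPolynomial k ha hz
  have hw1 : ∑ i, w i = 1 := by simpa [dyck] using hmom 0
  have hν₀ := atomicMeasure_mem_probMoments hx hw hw1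
  refine ⟨⟨_, hν₀, fun l => ?_⟩, q, hpos, hs, fun ν hν hm => ?_⟩
  · rw [mom_atomicMeasure x hw, hmom]
  · have hd : q.natDegree < k + 1 + 1 := by omega
    -- Monicity isolates the moment of order k + 1 in the integral of q. The lower moments of ν and
    -- of the quadrature agree, and q integrates to zero against the quadrature.
    have hc : q.coeff (k + 1) = 1 := by rw [← hdeg]; exact hmon
    have h1 := integral_polynomial hν.2.2 q hd
    have h2 := integral_polynomial hν₀.2.2 q hd
    rw [integral_atomicMeasure x hw] at h2
    simp only [hroot, mul_zero, Finset.sum_const_zero, mom_atomicMeasure x hw, hmom] at h2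
    rw [Finset.sum_range_succ, hc, one_mul] at h1 h2
    have h3 : ∑ i ∈ Finset.range (k + 1), q.coeff i * mom ν i =
        ∑ i ∈ Finset.range (k + 1), q.coeff i * dyck a (2 * i) 0 := by
      refine Finset.sum_congr rfl fun i hi => ?_
      rcases Nat.eq_zero_or_pos i with rfl | hi0
      · rw [mom_zero hν, mul_zero, dyck]
      · rw [hm i (Finset.mem_Icc.2 ⟨hi0, by have := Finset.mem_range.1 hi; omega⟩)]
    linarith

theorem integral_nonneg_of_nonneg_Ici {ν : Measure ℝ} (hν : ν (Set.Ici 0)ᶜ = 0) {f : ℝ → ℝ}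
    (hf : ∀ y, 0 ≤ y → 0 ≤ f y) : 0 ≤ ∫ y, f y ∂ν := by
  refine integral_nonneg_of_ae ?_
  have : ∀ᵐ y ∂ν, y ∈ Set.Ici (0 : ℝ) := hν
  filter_upwards [this] with y hy using hf y hy

/-! ### The lower bounds of the moments -/

theorem dyck_truncSeq_of_le (a : ℕ → ℝ) {i k : ℕ} (hi : i ≤ k) :
    dyck (truncSeq k a) (2 * i) 0 = dyck a (2 * i) 0 :=
  dyck_congr fun j hj => by rw [truncSeq, if_pos (by omega)]

/-- Truncation keeps the first k moments and supplies a quadrature attaining the bound; for any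
competitor the gap is the integral of a polynomial nonnegative on the half line. -/
theorem lowerMom_succ_eq {N : ℕ} (m : Fin N → ℝ) (k : ℕ) {a : ℕ → ℝ} (ha : ∀ j < k, 0 ≤ a j)
    (hm : ∀ i ∈ Finset.Icc 1 k, entry m i = dyck a (2 * i) 0) :
    lowerMom m (k + 1) = dyck (truncSeq k a) (2 * (k + 1)) 0 := by
  have hm' : ∀ i ∈ Finset.Icc 1 k, entry m i = dyck (truncSeq k a) (2 * i) 0 := fun i hi => by
    rw [hm i hi, dyck_truncSeq_of_le a (Finset.mem_Icc.1 hi).2]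
  obtain ⟨⟨ν₀, hν₀, hmom⟩, q, hq, -, hgap⟩ := exists_moment_gap k (truncSeq_nonneg ha)
    (fun j hj => by rw [truncSeq, if_neg (by omega)])
  rw [lowerMom, if_neg (Nat.succ_ne_zero k)]
  refine IsLeast.csInf_eq ⟨⟨ν₀, hν₀, fun i hi => ?_, (hmom _).symm⟩, ?_⟩
  · rw [hmom, hm' i hi]
  · rintro _ ⟨ν, hν, hνm, rfl⟩
    rw [hgap ν hν fun i hi => by rw [hνm i hi, hm' i hi]]
    have := integral_nonneg_of_nonneg_Ici hν.2.1 hq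
    linarith

theorem entry_sub_lowerMom {N : ℕ} (m : Fin N → ℝ) (k : ℕ) {a : ℕ → ℝ} (ha : ∀ j < k, 0 ≤ a j)
    (hm : ∀ i ∈ Finset.Icc 1 k, entry m i = dyck a (2 * i) 0) :
    entry m k - lowerMom m k = ∏ j ∈ Finset.range k, a j := by
  cases k with
  -- Here the conventions m_0 = 1 and m_0^- = 0 match the empty product.
  | zero => simp [entry, lowerMom]
  | succ k =>
    rw [lowerMom_succ_eq m k (fun j hj => ha j (by omega)) fun i hi => hm i (by
      rw [Finset.mem_Icc] at hi ⊢; omega), hm (k + 1) (by simp), dyck_even_eq]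
    ring

/-- The moment vectors all of whose entries exceed the lower bound. -/
def posRegion (N : ℕ) : Set (Fin N → ℝ) :=
  {m | ∀ k ∈ Finset.Icc 1 N, lowerMom m k < entry m k}

/-- Recursion coefficients recovered from a moment vector. -/
theorem exists_recursion_of_lowerMom_lt {N : ℕ} (m : Fin N → ℝ) (K : ℕ)
    (hm : ∀ k ∈ Finset.Icc 1 K, lowerMom m k < entry m k) :
    (∀ j < K, 0 < zCoord m (j + 1)) ∧
      ∀ i ∈ Finset.Icc 1 K, entry m i = dyck (fun j => zCoord m (j + 1)) (2 * i) 0 := by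
  induction K with
  | zero => simp
  | succ K ih =>
    obtain ⟨h1, h2⟩ := ih fun k hk => hm k (by rw [Finset.mem_Icc] at hk ⊢; omega)
    have hgap := entry_sub_lowerMom m K (fun j hj => (h1 j hj).le) h2
    have hpos : 0 < ∏ j ∈ Finset.range K, zCoord m (j + 1) :=
      Finset.prod_pos fun j hj => h1 j (Finset.mem_range.1 hj)
    have hK := hm (K + 1) (by simp)
    have hz : zCoord m (K + 1) = (entry m (K + 1) - lowerMom m (K + 1)) /
        ∏ j ∈ Finset.range K, zCoord m (j + 1) := by
      rw [← hgap]; rfl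
    refine ⟨fun j hj => ?_, fun i hi => ?_⟩
    · rcases Nat.lt_succ_iff_lt_or_eq.1 hj with hj | rfl
      · exact h1 j hj
      · rw [hz]; exact div_pos (sub_pos.2 hK) hpos
    · rcases (Finset.mem_Icc.1 hi).2.lt_or_eq with hlt | rfl
      · exact h2 i (Finset.mem_Icc.2 ⟨(Finset.mem_Icc.1 hi).1, by omega⟩)
      · rw [dyck_even_eq, ← lowerMom_succ_eq m K (fun j hj => (h1 j hj).le) h2,
          Finset.prod_range_succ, hz, mul_div_cancel₀ _ hpos.ne']
        ring

/-- The vector `z` followed by zeros. -/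
def extendSeq {N : ℕ} (z : Fin N → ℝ) : ℕ → ℝ := fun j => if h : j < N then z ⟨j, h⟩ else 0

/-- The moments as functions of the recursion coefficients. -/
def momOfRec (N : ℕ) (z : Fin N → ℝ) : Fin N → ℝ :=
  fun i => dyck (extendSeq z) (2 * (i + 1)) 0

theorem entry_momOfRec {N : ℕ} (z : Fin N → ℝ) {i : ℕ} (hi : i ∈ Finset.Icc 1 N) :
    entry (momOfRec N z) i = dyck (extendSeq z) (2 * i) 0 := by
  rw [Finset.mem_Icc] at hi
  rw [entry, if_neg (by omega), dif_pos (by omega), momOfRec]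
  simp only
  rw [Nat.sub_add_cancel hi.1]

theorem extendSeq_pos {N : ℕ} {z : Fin N → ℝ} (hz : ∀ i, 0 < z i) {j : ℕ} (hj : j < N) :
    0 < extendSeq z j := by
  rw [extendSeq, dif_pos hj]; exact hz _

theorem extendSeq_nonneg {N : ℕ} {z : Fin N → ℝ} (hz : ∀ i, 0 < z i) (j : ℕ) :
    0 ≤ extendSeq z j := by
  rw [extendSeq]; split_ifs
  · exact (hz _).le
  · exact le_rfl

theorem gap_momOfRec {N : ℕ} {z : Fin N → ℝ} (hz : ∀ i, 0 < z i) {k : ℕ} (hk : k ≤ N) :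
    entry (momOfRec N z) k - lowerMom (momOfRec N z) k = ∏ j ∈ Finset.range k, extendSeq z j :=
  entry_sub_lowerMom _ k (fun j _ => extendSeq_nonneg hz j) fun i hi =>
    entry_momOfRec z (by rw [Finset.mem_Icc] at hi ⊢; omega)

theorem zCoord_momOfRec {N : ℕ} {z : Fin N → ℝ} (hz : ∀ i, 0 < z i) (i : Fin N) :
    zCoord (momOfRec N z) (i + 1) = z i := by
  rw [zCoord, gap_momOfRec hz i.2, Nat.add_sub_cancel, gap_momOfRec hz i.2.le,
    Finset.prod_range_succ, mul_div_cancel_left₀]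
  · simp [extendSeq]
  · exact (Finset.prod_pos fun j hj =>
      extendSeq_pos hz ((Finset.mem_range.1 hj).trans i.2)).ne'

theorem injOn_momOfRec (N : ℕ) : Set.InjOn (momOfRec N) {z | ∀ i, 0 < z i} := by
  intro z hz z' hz' h
  funext i
  rw [← zCoord_momOfRec hz i, h, zCoord_momOfRec hz' i]

theorem image_momOfRec (N : ℕ) : momOfRec N '' {z | ∀ i, 0 < z i} = posRegion N := by
  ext m
  constructor
  · rintro ⟨z, hz, rfl⟩ k hk
    rw [Finset.mem_Icc] at hk
    rw [← sub_pos, gap_momOfRec hz hk.2]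
    exact Finset.prod_pos fun j hj => extendSeq_pos hz ((Finset.mem_range.1 hj).trans_le hk.2)
  · intro hm
    obtain ⟨h1, h2⟩ := exists_recursion_of_lowerMom_lt m N hm
    refine ⟨fun i => zCoord m (i + 1), fun i => h1 i i.2, ?_⟩
    funext i
    have h3 := h2 (i + 1) (Finset.mem_Icc.2 ⟨by omega, i.2⟩)
    have h4 : entry m (i + 1) = m i := by
      rw [entry, if_neg (by omega), dif_pos (by simp)]; rfl
    rw [← h4, h3, momOfRec]
    refine dyck_congr fun j hj => ?_
    rw [extendSeq, dif_pos (by omega)]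

theorem entry_momVec {N : ℕ} (ν : Measure ℝ) {i : ℕ} (hi : i ∈ Finset.Icc 1 N) :
    entry (momVec N ν) i = mom ν i := by
  rw [Finset.mem_Icc] at hi
  rw [entry, if_neg (by omega), dif_pos (by omega), momVec]
  simp only
  rw [Nat.sub_add_cancel hi.1]

/-- The gap at order K + 1 ≤ 2n - 1 is the integral of a nonnegative polynomial with at most (K +
1)/2 < n positive zeros. It cannot vanish at n distinct positive atoms, so the integral is positive.
-/
theorem momVec_atomicMeasure_mem_posRegion {n : ℕ} {x w : Fin n → ℝ}
    (hinj : Function.Injective x) (hx : ∀ i, 0 < x i) (hw : ∀ i, 0 < w i) (hw1 : ∑ i, w i = 1) :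
    momVec (2 * n - 1) (atomicMeasure n (x, w)) ∈ posRegion (2 * n - 1) := by
  classical
  have hν := atomicMeasure_mem_probMoments (fun i => (hx i).le) (fun i => (hw i).le) hw1
  set m := momVec (2 * n - 1) (atomicMeasure n (x, w)) with hmdef
  suffices h : ∀ K ≤ 2 * n - 1, ∀ k ∈ Finset.Icc 1 K, lowerMom m k < entry m k from h _ le_rfl
  intro K
  induction K with
  | zero => simp
  | succ K ih =>
    intro hK k hk
    rcases (Finset.mem_Icc.1 hk).2.lt_or_eq with hlt | rfl
    · exact ih (by omega) k (Finset.mem_Icc.2 ⟨(Finset.mem_Icc.1 hk).1, by omega⟩)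
    obtain ⟨h1, h2⟩ := exists_recursion_of_lowerMom_lt m K (ih (by omega))
    rw [lowerMom_succ_eq m K (fun j hj => (h1 j hj).le) h2, hmdef,
      entry_momVec _ (Finset.mem_Icc.2 ⟨by omega, hK⟩)]
    obtain ⟨-, q, hq, ⟨s, hs, hroots⟩, hgap⟩ := exists_moment_gap K
      (truncSeq_nonneg (fun j hj => (h1 j hj).le))
      (fun j hj => by rw [truncSeq, if_neg (by omega)])
    rw [hgap _ hν fun i hi => by
      rw [dyck_truncSeq_of_le _ (Finset.mem_Icc.1 hi).2, ← h2 i hi, hmdef, entry_momVec]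
      rw [Finset.mem_Icc] at hi ⊢; omega]
    rw [integral_atomicMeasure x fun i => (hw i).le, lt_add_iff_pos_right]
    have hterm : ∀ i, 0 ≤ w i * q.eval (x i) := fun i => mul_nonneg (hw i).le (hq _ (hx i).le)
    refine (Finset.sum_nonneg fun i _ => hterm i).lt_of_ne fun h => ?_
    have hzero := (Finset.sum_eq_zero_iff_of_nonneg fun i _ => hterm i).1 h.symm
    have hsub : Finset.univ.image x ⊆ s := by
      intro y hy
      obtain ⟨i, hi, rfl⟩ := Finset.mem_image.1 hy
      exact hroots _ (hx i) ((mul_eq_zero.1 (hzero i hi)).resolve_left (hw i).ne')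
    have := Finset.card_le_card hsub
    rw [Finset.card_image_of_injective _ hinj, Finset.card_univ, Fintype.card_fin] at this
    omega

/-! ### The confluent Vandermonde determinant -/

/-- The product of the distances of all ordered pairs of distinct indices. -/
noncomputable def pairProd {ι : Type*} [Fintype ι] [DecidableEq ι] (v : ι → ℝ) : ℝ :=
  ∏ i, ∏ j, if i = j then 1 else |v i - v j|

theorem pairProd_comp_equiv {ι κ : Type*} [Fintype ι] [DecidableEq ι] [Fintype κ] [DecidableEq κ]
    (v : ι → ℝ) (e : κ ≃ ι) : pairProd (v ∘ e) = pairProd v := by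
  unfold pairProd
  rw [← e.prod_comp]
  refine Finset.prod_congr rfl fun i _ => ?_
  rw [← e.prod_comp]
  simp

theorem det_vandermonde_sq {m : ℕ} (v : Fin m → ℝ) :
    (Matrix.vandermonde v).det ^ 2 = pairProd v := by
  classical
  have hle : ∀ i : Fin m, (∏ j, if i = j then 1 else |v i - v j|) =
      (∏ j, if i < j then |v j - v i| else 1) * ∏ j, if j < i then |v j - v i| else 1 := by
    intro i
    rw [← Finset.prod_mul_distrib]
    refine Finset.prod_congr rfl fun j _ => ?_
    rcases lt_trichotomy i j with h | h | h
    · simp [h, h.ne, h.not_gt, abs_sub_comm]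
    · simp [h]
    · simp [h, h.ne', h.not_gt, abs_sub_comm]
  unfold pairProd
  rw [Finset.prod_congr rfl fun i _ => hle i, Finset.prod_mul_distrib,
    Finset.prod_comm (f := fun i j => if j < i then |v j - v i| else 1), Matrix.det_vandermonde]
  have h1 : ∏ i, ∏ j, (if i < j then |v j - v i| else 1) =
      |∏ i, ∏ j ∈ Finset.Ioi i, (v j - v i)| := by
    rw [Finset.abs_prod]
    refine Finset.prod_congr rfl fun i _ => ?_
    rw [Finset.abs_prod, ← Finset.prod_filter]
    congr 1
    ext j; simp
  have h2 : ∏ i, ∏ j, (if i < j then |v i - v j| else 1) =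
      |∏ i, ∏ j ∈ Finset.Ioi i, (v j - v i)| := by
    rw [← h1]
    exact Finset.prod_congr rfl fun i _ => Finset.prod_congr rfl fun j _ => by
      rw [abs_sub_comm]
  rw [h1, h2, ← sq, sq_abs]

theorem det_pow_sq {ι : Type*} [Fintype ι] [DecidableEq ι] {m : ℕ} (e : ι ≃ Fin m) (v : ι → ℝ) :
    (Matrix.of fun i j => v j ^ (e i : ℕ)).det ^ 2 = pairProd v := by
  rw [← pairProd_comp_equiv v e.symm, ← det_vandermonde_sq, ← Matrix.det_transpose,
    ← Matrix.det_submatrix_equiv_self e]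
  congr 2
  ext i j
  simp [Matrix.vandermonde_apply]

theorem continuous_pairProd_shift {ι : Type*} [Fintype ι] [DecidableEq ι] (x : ι → ℝ) :
    Continuous fun h : ℝ => ∏ i, ∏ j, if i = j then 1 else |x i - (x j + h)| := by
  refine continuous_finsetProd _ fun i _ => continuous_finsetProd _ fun j _ => ?_
  split_ifs <;> fun_prop

theorem pairProd_sumElim_shift {ι : Type*} [Fintype ι] [DecidableEq ι] (x : ι → ℝ) {h : ℝ}
    (hh : 0 < h) : pairProd (Sum.elim x fun i => x i + h) =
      pairProd x ^ 2 * (h ^ Fintype.card ι *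
        ∏ i, ∏ j, if i = j then 1 else |x i - (x j + h)|) ^ 2 := by
  have h1 : ∏ i, ∏ j, |x i - (x j + h)| =
      h ^ Fintype.card ι * ∏ i, ∏ j, if i = j then 1 else |x i - (x j + h)| := by
    rw [← Finset.card_univ, ← Finset.prod_const, ← Finset.prod_mul_distrib]
    refine Finset.prod_congr rfl fun i _ => ?_
    have : ∀ j, |x i - (x j + h)| =
        (if i = j then h else 1) * if i = j then 1 else |x i - (x j + h)| := by
      intro j
      split_ifs with hij
      · subst hij; simp [abs_of_pos hh]
      · simp
    rw [Finset.prod_congr rfl fun j _ => this j, Finset.prod_mul_distrib, Finset.prod_ite_eq]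
    simp
  have h2 : ∏ i, ∏ j, |x i + h - x j| = ∏ i, ∏ j, |x i - (x j + h)| := by
    rw [Finset.prod_comm]
    exact Finset.prod_congr rfl fun i _ => Finset.prod_congr rfl fun j _ => by
      rw [abs_sub_comm]
  rw [← h1]
  simp only [pairProd, Fintype.prod_sum_type, Sum.elim_inl, Sum.elim_inr, Sum.inl.injEq,
    Sum.inr.injEq, reduceCtorEq, if_false, Finset.prod_mul_distrib, h2, add_sub_add_right_eq_sub]
  ring

/-- Limit of the ordinary Vandermonde determinant for the doubled nodes x_j and x_j + h as h ↓ 0,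
after the second block of columns is replaced by difference quotients. The factor h^{2|ι|} in the
squared determinant cancels against the scaling by h⁻¹. -/
theorem det_confluent_sq {ι : Type*} [Fintype ι] [DecidableEq ι] {m : ℕ} (e : ι ⊕ ι ≃ Fin m)
    (x : ι → ℝ) :
    (Matrix.of fun i j => Sum.elim (fun j => x j ^ (e i : ℕ))
      (fun j => (e i : ℝ) * x j ^ ((e i : ℕ) - 1)) j).det ^ 2 = pairProd x ^ 4 := by
  set W : ℝ → Matrix (ι ⊕ ι) (ι ⊕ ι) ℝ := fun h => Matrix.of fun i j =>
    Sum.elim (fun j => x j ^ (e i : ℕ))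
      (fun j => h⁻¹ * ((x j + h) ^ (e i : ℕ) - x j ^ (e i : ℕ))) j with hW
  -- Column operation turning the values at x and x + h into values at x and difference quotients.
  set T : ℝ → Matrix (ι ⊕ ι) (ι ⊕ ι) ℝ := fun h => Matrix.fromBlocks 1 (-(h⁻¹ • 1)) 0 (h⁻¹ • 1)
    with hT
  have hWT : ∀ h, W h =
      (Matrix.of fun i j => (Sum.elim x fun i => x i + h) j ^ (e i : ℕ)) * T h := by
    intro h
    ext i j
    rcases j with j | j
    · simp [hW, hT, Matrix.mul_apply, Fintype.sum_sum_type, Matrix.one_apply]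
    · simp [hW, hT, Matrix.mul_apply, Fintype.sum_sum_type, Matrix.one_apply]
      ring
  have hdet : ∀ h, 0 < h → (W h).det ^ 2 =
      pairProd x ^ 2 * (∏ i, ∏ j, if i = j then 1 else |x i - (x j + h)|) ^ 2 := by
    intro h hh
    rw [hWT, Matrix.det_mul, mul_pow, det_pow_sq e, pairProd_sumElim_shift x hh, hT,
      Matrix.det_fromBlocks_zero₂₁, Matrix.det_smul]
    simp only [Matrix.det_one, one_mul, mul_one, inv_pow]
    field_simp
  have hlim1 : Filter.Tendsto (fun h => (W h).det ^ 2) (nhdsWithin 0 (Set.Ioi 0))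
      (nhds ((Matrix.of fun i j => Sum.elim (fun j => x j ^ (e i : ℕ))
        (fun j => (e i : ℝ) * x j ^ ((e i : ℕ) - 1)) j).det ^ 2)) := by
    have hM : Filter.Tendsto W (nhdsWithin 0 (Set.Ioi 0))
      (nhds (Matrix.of fun i j => Sum.elim (fun j => x j ^ (e i : ℕ))
        (fun j => (e i : ℝ) * x j ^ ((e i : ℕ) - 1)) j)) := by
      refine tendsto_pi_nhds.2 fun i => tendsto_pi_nhds.2 fun j => ?_
      rcases j with j | j
      · simp [hW]
      · have := (hasDerivAt_pow (e i : ℕ) (x j)).tendsto_slope_zero_right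
        simpa [hW] using this
    have hc : Continuous fun M : Matrix (ι ⊕ ι) (ι ⊕ ι) ℝ => M.det ^ 2 :=
      (Continuous.matrix_det continuous_id).pow 2
    exact (hc.tendsto _).comp hM
  have hlim2 : Filter.Tendsto (fun h => (W h).det ^ 2) (nhdsWithin 0 (Set.Ioi 0))
      (nhds (pairProd x ^ 4)) := by
    have hc := (((continuous_pairProd_shift x).pow 2).const_mul (pairProd x ^ 2)).tendsto 0
    have hval : pairProd x ^ 2 * (∏ i, ∏ j, if i = j then 1 else |x i - (x j + 0)|) ^ 2 =
        pairProd x ^ 4 := by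
      simp only [add_zero]
      change pairProd x ^ 2 * pairProd x ^ 2 = _
      ring
    change Filter.Tendsto _ _ (nhds (pairProd x ^ 2 *
      (∏ i, ∏ j, if i = j then 1 else |x i - (x j + 0)|) ^ 2)) at hc
    rw [hval] at hc
    refine (hc.mono_left nhdsWithin_le_nhds).congr' ?_
    filter_upwards [self_mem_nhdsWithin] with h hh
    exact (hdet h hh).symm
  exact tendsto_nhds_unique hlim1 hlim2

/-- In the full confluent matrix, the exponent-zero row is 1 on value columns and 0 on derivative
columns. Subtracting the last node's value column from the other value columns leaves a single 1 in
that row, and expanding along it gives the reduced matrix. -/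
theorem det_reduced_confluent_sq {r N : ℕ} (e : Fin r ⊕ Fin (r + 1) ≃ Fin N)
    (x : Fin (r + 1) → ℝ) :
    (Matrix.of fun i j => Sum.elim
      (fun j : Fin r => x j.castSucc ^ ((e i : ℕ) + 1) - x (Fin.last r) ^ ((e i : ℕ) + 1))
      (fun j : Fin (r + 1) => ((e i : ℝ) + 1) * x j ^ (e i : ℕ)) j).det ^ 2 = pairProd x ^ 4 := by
  -- The extra index `Unit` stands for the value column of the last node here, and for the row of
  -- exponent 0 in `kfun`.
  let gfun : Unit ⊕ (Fin r ⊕ Fin (r + 1)) → Fin (r + 1) ⊕ Fin (r + 1) :=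
    Sum.elim (fun _ => Sum.inl (Fin.last r)) (Sum.elim (fun j => Sum.inl j.castSucc) Sum.inr)
  have hg : Function.Bijective gfun := by
    rw [Fintype.bijective_iff_injective_and_card]
    refine ⟨?_, by simp; ring⟩
    rintro (a | a | a) (b | b | b) hab <;> simp [gfun, Fin.ext_iff] at hab ⊢ <;> omega
  obtain ⟨g, hg'⟩ : ∃ g : Unit ⊕ (Fin r ⊕ Fin (r + 1)) ≃ Fin (r + 1) ⊕ Fin (r + 1),
    ∀ b, g b = gfun b := ⟨Equiv.ofBijective gfun hg, fun _ => rfl⟩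
  let kfun : Unit ⊕ (Fin r ⊕ Fin (r + 1)) → Fin (N + 1) :=
    Sum.elim (fun _ => 0) fun i => (e i).succ
  have hk : Function.Bijective kfun := by
    rw [Fintype.bijective_iff_injective_and_card]
    refine ⟨?_, by have := Fintype.card_congr e; simp at this ⊢; omega⟩
    rintro (a | a) (b | b) hab
    · rfl
    · exact absurd hab (by simp [kfun, (Fin.succ_ne_zero _).symm])
    · exact absurd hab (by simp [kfun])
    · simpa [kfun] using hab
  obtain ⟨k, hk'⟩ : ∃ k : Unit ⊕ (Fin r ⊕ Fin (r + 1)) ≃ Fin (N + 1),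
    ∀ b, k b = kfun b := ⟨Equiv.ofBijective kfun hk, fun _ => rfl⟩
  have hrow : ∀ b, (g.symm.trans k) (g b) = kfun b := fun b => by simp [hk']
  rw [← det_confluent_sq (g.symm.trans k) x, ← Matrix.det_submatrix_equiv_self g]
  congr 1
  symm
  -- Transposition turns the column operations into row operations; adding back the `Unit` row with
  -- coefficient 1 on value rows and 0 on derivative rows recovers the full matrix.
  rw [← Matrix.det_transpose]
  rw [Matrix.det_eq_of_forall_row_eq_smul_add_const
    (B := (Matrix.fromBlocks 1 0 (Matrix.of fun i _ => x (Fin.last r) ^ ((e i : ℕ) + 1))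
      (Matrix.of fun i j => Sum.elim
      (fun j : Fin r => x j.castSucc ^ ((e i : ℕ) + 1) - x (Fin.last r) ^ ((e i : ℕ) + 1))
      (fun j : Fin (r + 1) => ((e i : ℝ) + 1) * x j ^ (e i : ℕ)) j)).transpose)
    (Sum.elim (fun _ => 0) (Sum.elim (fun _ => 1) fun _ => 0)) (Sum.inl ()) rfl]
  · rw [Matrix.det_transpose, Matrix.det_fromBlocks_zero₁₂]
    simp
  · intro a b
    simp only [Matrix.transpose_apply, Matrix.submatrix_apply, Matrix.of_apply]
    rw [hrow, hg']
    rcases a with a | a | a <;> rcases b with b | b <;> simp [gfun, kfun]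

/-! ### Change of variables from nodes and weights to moments -/

/-- The weights `(p_1, …, p_r, 1 - p_1 - ⋯ - p_r)`. -/
def weightOf {r : ℕ} (p : Fin r → ℝ) : Fin (r + 1) → ℝ :=
  Fin.lastCases (1 - ∑ j, p j) p

@[simp] theorem weightOf_castSucc {r : ℕ} (p : Fin r → ℝ) (j : Fin r) :
    weightOf p j.castSucc = p j := by simp [weightOf]

@[simp] theorem weightOf_last {r : ℕ} (p : Fin r → ℝ) :
    weightOf p (Fin.last r) = 1 - ∑ j, p j := by simp [weightOf]

theorem sum_weightOf {r : ℕ} (p : Fin r → ℝ) : ∑ i, weightOf p i = 1 := by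
  simp [Fin.sum_univ_castSucc]

/-- The moments of a finitely supported measure, where weights and nodes are joined in one
vector. -/
def nodeMom {r N : ℕ} (e : Fin r ⊕ Fin (r + 1) ≃ Fin N) (y : Fin r ⊕ Fin (r + 1) → ℝ) :
    Fin r ⊕ Fin (r + 1) → ℝ :=
  fun i => ∑ j, weightOf (fun j => y (Sum.inl j)) j * y (Sum.inr j) ^ ((e i : ℕ) + 1)

/-- The Jacobi matrix of `nodeMom`. -/
def nodeMomDeriv {r N : ℕ} (e : Fin r ⊕ Fin (r + 1) ≃ Fin N) (y : Fin r ⊕ Fin (r + 1) → ℝ) :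
    Matrix (Fin r ⊕ Fin (r + 1)) (Fin r ⊕ Fin (r + 1)) ℝ :=
  Matrix.of fun i j => Sum.elim
    (fun j : Fin r => y (Sum.inr j.castSucc) ^ ((e i : ℕ) + 1) -
      y (Sum.inr (Fin.last r)) ^ ((e i : ℕ) + 1))
    (fun j : Fin (r + 1) => weightOf (fun j => y (Sum.inl j)) j *
      (((e i : ℝ) + 1) * y (Sum.inr j) ^ (e i : ℕ))) j

/-- Each derivative column carries its weight as a factor; the rest is the reduced confluent
determinant. As `pairProd` runs over ordered pairs, its square is Δ^4. -/
theorem det_nodeMomDeriv {r N : ℕ} (e : Fin r ⊕ Fin (r + 1) ≃ Fin N)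
    (y : Fin r ⊕ Fin (r + 1) → ℝ) :
    |(nodeMomDeriv e y).det| =
      |∏ j, weightOf (fun j => y (Sum.inl j)) j| * pairProd (fun j => y (Sum.inr j)) ^ 2 := by
  have h := Matrix.det_mul_row
    (Sum.elim (fun _ => 1) (weightOf (fun j => y (Sum.inl j)))) (Matrix.of fun i j => Sum.elim
      (fun j : Fin r => y (Sum.inr j.castSucc) ^ ((e i : ℕ) + 1) -
        y (Sum.inr (Fin.last r)) ^ ((e i : ℕ) + 1))
      (fun j : Fin (r + 1) => ((e i : ℝ) + 1) * y (Sum.inr j) ^ (e i : ℕ)) j)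
  have h1 : (Matrix.of fun i j => (Sum.elim (fun _ => 1) (weightOf (fun j => y (Sum.inl j)))) j *
      (Matrix.of fun i j => Sum.elim
      (fun j : Fin r => y (Sum.inr j.castSucc) ^ ((e i : ℕ) + 1) -
        y (Sum.inr (Fin.last r)) ^ ((e i : ℕ) + 1))
      (fun j : Fin (r + 1) => ((e i : ℝ) + 1) * y (Sum.inr j) ^ (e i : ℕ)) j) i j) =
      nodeMomDeriv e y := by
    ext i j
    rcases j with j | j <;> simp [nodeMomDeriv]
  rw [h1] at h
  rw [h, abs_mul, Fintype.prod_sum_type]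
  simp only [Sum.elim_inl, Sum.elim_inr, Finset.prod_const_one, one_mul]
  congr 1
  rw [← abs_of_nonneg (sq_nonneg (pairProd fun j => y (Sum.inr j))), ← sq_eq_sq_iff_abs_eq_abs,
    det_reduced_confluent_sq e (fun j => y (Sum.inr j))]
  ring

theorem hasFDerivAt_nodeMom {r N : ℕ} (e : Fin r ⊕ Fin (r + 1) ≃ Fin N)
    (y : Fin r ⊕ Fin (r + 1) → ℝ) :
    HasFDerivAt (nodeMom e) (Matrix.toLin' (nodeMomDeriv e y)).toContinuousLinearMap y := by
  rw [hasFDerivAt_pi']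
  intro i
  have hp : ∀ j : Fin r ⊕ Fin (r + 1), HasFDerivAt (fun y : Fin r ⊕ Fin (r + 1) → ℝ => y j)
      (ContinuousLinearMap.proj (R := ℝ) (φ := fun _ : Fin r ⊕ Fin (r + 1) => ℝ) j) y :=
    fun j => hasFDerivAt_apply j y
  have h := (HasFDerivAt.fun_sum (u := Finset.univ) fun (j : Fin r) _ =>
    (hp (Sum.inl j)).mul (HasFDerivAt.pow (hp (Sum.inr j.castSucc)) ((e i : ℕ) + 1))).add
    (((HasFDerivAt.fun_sum (u := Finset.univ) fun (j : Fin r) _ => hp (Sum.inl j)).const_sub 1).mul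
      (HasFDerivAt.pow (hp (Sum.inr (Fin.last r))) ((e i : ℕ) + 1)))
  refine (h.congr_fderiv ?_).congr_of_eventuallyEq ?_
  · ext v
    simp only [add_apply, sum_apply,
      smul_apply, ContinuousLinearMap.proj_apply, smul_eq_mul,
      neg_apply, ContinuousLinearMap.comp_apply,
      LinearMap.coe_toContinuousLinearMap', Matrix.toLin'_apply, Matrix.mulVec, dotProduct,
      Fintype.sum_sum_type, nodeMomDeriv, Matrix.of_apply, Sum.elim_inl, Sum.elim_inr,
      Fin.sum_univ_castSucc, weightOf_castSucc, weightOf_last, Finset.sum_add_distrib,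
      sub_mul, Finset.sum_sub_distrib]
    simp only [Nat.add_sub_cancel, Nat.cast_add, Nat.cast_one, nsmul_eq_mul, ← Finset.mul_sum,
      ← mul_assoc]
    ring
  · refine Filter.Eventually.of_forall fun v => ?_
    simp [nodeMom, Fin.sum_univ_castSucc]

/-! ### Change of variables from recursion coefficients to moments -/

theorem differentiable_dyck_extendSeq (N l h : ℕ) :
    Differentiable ℝ fun z : Fin N → ℝ => dyck (extendSeq z) l h := by
  have he : ∀ j, Differentiable ℝ fun z : Fin N → ℝ => extendSeq z j := by
    intro j
    unfold extendSeq
    split_ifs <;> fun_prop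
  induction l generalizing h with
  | zero => cases h <;> exact differentiable_const _
  | succ l ih =>
    cases h with
    | zero => exact (he 0).mul (ih 1)
    | succ h => exact (ih h).add ((he _).mul (ih _))

theorem differentiable_momOfRec (N : ℕ) : Differentiable ℝ (momOfRec N) :=
  differentiable_pi.2 fun _ => differentiable_dyck_extendSeq _ _ _

/-- The moment with index i involves only z_0, …, z_i and is affine in z_i with slope z_0⋯z_{i-1},
so the Jacobian is triangular. -/
theorem det_fderiv_momOfRec {N : ℕ} (z : Fin N → ℝ) :
    (fderiv ℝ (momOfRec N) z).det = ∏ k : Fin N, ∏ j ∈ Finset.range k, extendSeq z j := by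
  have hline : ∀ i j : Fin N, HasDerivAt
      (fun t : ℝ => momOfRec N (z + t • Pi.single j 1) i)
      (fderiv ℝ (momOfRec N) z (Pi.single j 1) i) 0 := fun i j =>
    hasDerivAt_pi.1 ((differentiable_momOfRec N z).hasFDerivAt.hasLineDerivAt
      (Pi.single j 1)) i
  have hext : ∀ (j : Fin N) (t : ℝ) (l : ℕ), extendSeq (z + t • Pi.single j 1) l =
      extendSeq z l + if l = j then t else 0 := by
    intro j t l
    unfold extendSeq
    by_cases hl : l < N
    · by_cases hj : l = j
      · subst hj; simp
      · rw [dif_pos hl, dif_pos hl, if_neg hj]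
        simp [Fin.ext_iff, hj]
    · rw [dif_neg hl, dif_neg hl, if_neg (by omega), add_zero]
  have hupper : ∀ i j : Fin N, i < j → fderiv ℝ (momOfRec N) z (Pi.single j 1) i = 0 := by
    intro i j hij
    refine (hline i j).unique ((hasDerivAt_const (0 : ℝ) (momOfRec N z i)).congr_of_eventuallyEq ?_)
    refine Filter.Eventually.of_forall fun t => dyck_congr fun l hl => ?_
    have : (i : ℕ) < j := hij
    rw [hext, if_neg (by omega), add_zero]
  have hdiag : ∀ i : Fin N, fderiv ℝ (momOfRec N) z (Pi.single i 1) i =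
      ∏ j ∈ Finset.range i, extendSeq z j := by
    intro i
    have h1 : HasDerivAt (fun t : ℝ => dyck (truncSeq i (extendSeq z)) (2 * ((i : ℕ) + 1)) 0 +
        (∏ j ∈ Finset.range i, extendSeq z j) * (extendSeq z i + t))
        ((∏ j ∈ Finset.range i, extendSeq z j) * 1) 0 :=
      (((hasDerivAt_id (0 : ℝ)).const_add _).const_mul _).const_add _
    rw [mul_one] at h1
    refine (hline i i).unique (h1.congr_of_eventuallyEq ?_)
    refine Filter.Eventually.of_forall fun t => ?_
    simp only [momOfRec]
    rw [dyck_even_eq, Finset.prod_range_succ, hext, if_pos rfl]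
    congr 1
    · congr 1
      funext l
      unfold truncSeq
      split_ifs with hl
      · rw [hext, if_neg (by omega), add_zero]
      · rfl
    · congr 1
      refine Finset.prod_congr rfl fun l hl => ?_
      rw [hext, if_neg (by have := Finset.mem_range.1 hl; omega), add_zero]
  rw [ContinuousLinearMap.det, ← LinearMap.det_toMatrix', Matrix.det_of_isLowerTriangular]
  · refine Finset.prod_congr rfl fun i _ => ?_
    rw [← hdiag i, LinearMap.toMatrix'_apply]
    rfl
  · intro i j hij
    rw [LinearMap.toMatrix'_apply]
    exact hupper i j hij

/-! ### Nodes and weights are determined by the moments -/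

-- Both supports together have at most 2n points. The product of the linear factors at all of them
-- except a has degree below 2n, so the given moments determine its integral, which is a nonzero
-- multiple of the mass at a.
open Polynomial in
theorem sum_weights_at_eq {n : ℕ} {x x' w w' : Fin n → ℝ}
    (h : ∀ k < 2 * n, ∑ i, w i * x i ^ k = ∑ i, w' i * x' i ^ k) (a : ℝ)
    (ha : a ∈ Set.range x ∪ Set.range x') :
    ∑ i, (if x i = a then w i else 0) = ∑ i, if x' i = a then w' i else 0 := by
  classical
  set s : Finset ℝ := Finset.univ.image x ∪ Finset.univ.image x' with hs
  have has : a ∈ s := by simpa [hs] using ha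
  have hcard : s.card ≤ 2 * n := by
    refine (Finset.card_union_le _ _).trans ?_
    have h1 := Finset.card_image_le (s := Finset.univ) (f := x)
    have h2 := Finset.card_image_le (s := Finset.univ) (f := x')
    simp only [Finset.card_univ, Fintype.card_fin] at h1 h2
    omega
  set q : ℝ[X] := ∏ b ∈ s.erase a, (X - C b) with hq
  have hdeg : q.natDegree < 2 * n := by
    rw [hq, natDegree_prod_of_monic _ _ fun i _ => monic_X_sub_C _]
    simp only [natDegree_X_sub_C, Finset.sum_const, smul_eq_mul, mul_one]
    exact (Finset.card_erase_lt_of_mem has).trans_le hcard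
  have hqa : q.eval a ≠ 0 := by
    rw [hq, eval_prod, Finset.prod_ne_zero_iff]
    intro b hb
    rw [eval_sub, eval_X, eval_C, sub_ne_zero]
    exact (Finset.ne_of_mem_erase hb).symm
  have hq0 : ∀ b ∈ s, b ≠ a → q.eval b = 0 := by
    intro b hb hba
    rw [hq, eval_prod]
    exact Finset.prod_eq_zero (Finset.mem_erase.2 ⟨hba, hb⟩) (by simp)
  have hsum : ∀ u v : Fin n → ℝ, ∑ i, v i * q.eval (u i) =
      ∑ k ∈ Finset.range (2 * n), q.coeff k * ∑ i, v i * u i ^ k := by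
    intro u v
    simp only [eval_eq_sum_range' hdeg, Finset.mul_sum]
    rw [Finset.sum_comm]
    exact Finset.sum_congr rfl fun k _ => Finset.sum_congr rfl fun i _ => by ring
  have heval : ∀ u v : Fin n → ℝ, (∀ i, u i ∈ s) →
      ∑ i, v i * q.eval (u i) = q.eval a * ∑ i, if u i = a then v i else 0 := by
    intro u v hu
    rw [Finset.mul_sum]
    refine Finset.sum_congr rfl fun i _ => ?_
    split_ifs with hi
    · rw [hi]; ring
    · rw [hq0 _ (hu i) hi]; ring
  refine mul_left_cancel₀ hqa ?_
  rw [← heval x w fun i => by simp [hs], ← heval x' w' fun i => by simp [hs], hsum, hsum]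
  exact Finset.sum_congr rfl fun k hk => by rw [h k (Finset.mem_range.1 hk)]

theorem range_subset_of_moments_eq {n : ℕ} {x x' w w' : Fin n → ℝ} (hw : ∀ i, 0 < w i)
    (h : ∀ k < 2 * n, ∑ i, w i * x i ^ k = ∑ i, w' i * x' i ^ k) :
    Set.range x ⊆ Set.range x' := by
  rintro _ ⟨i, rfl⟩
  by_contra hi
  have h1 := sum_weights_at_eq h (x i) (Or.inl ⟨i, rfl⟩)
  rw [Finset.sum_eq_zero (f := fun j => if x' j = x i then w' j else 0)] at h1
  · rw [Finset.sum_eq_zero_iff_of_nonneg] at h1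
    · have := h1 i (Finset.mem_univ i)
      rw [if_pos rfl] at this
      exact (hw i).ne' this
    · intro j _
      split_ifs
      · exact (hw j).le
      · exact le_rfl
  · intro j _
    rw [if_neg fun hj => hi ⟨j, hj⟩]

theorem nodes_weights_unique {n : ℕ} {σ : Equiv.Perm (Fin n)} {x x' w w' : Fin n → ℝ}
    (hx : StrictMono (x ∘ σ)) (hx' : StrictMono (x' ∘ σ)) (hw : ∀ i, 0 < w i)
    (hw' : ∀ i, 0 < w' i) (h : ∀ k < 2 * n, ∑ i, w i * x i ^ k = ∑ i, w' i * x' i ^ k) :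
    x = x' ∧ w = w' := by
  have hr : Set.range (x ∘ σ) = Set.range (x' ∘ σ) := by
    rw [σ.surjective.range_comp, σ.surjective.range_comp]
    exact (range_subset_of_moments_eq hw h).antisymm
      (range_subset_of_moments_eq hw' fun k hk => (h k hk).symm)
  have hxx : x = x' := σ.surjective.injective_comp_right ((StrictMono.range_inj hx hx').1 hr)
  subst hxx
  have hinj : Function.Injective x := by
    have := hx.injective.comp σ.symm.injective
    rwa [Function.comp_assoc, Equiv.self_comp_symm] at this
  refine ⟨rfl, funext fun i => ?_⟩
  have := sum_weights_at_eq h (x i) (Or.inl ⟨i, rfl⟩)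
  simpa [hinj.eq_iff] using this

/-! ### Chambers -/

/-- Strictly positive nodes in the order prescribed by `σ`, with strictly positive weights. -/
def chamber {r : ℕ} (σ : Equiv.Perm (Fin (r + 1))) : Set (Fin r ⊕ Fin (r + 1) → ℝ) :=
  {y | StrictMono ((fun j => y (Sum.inr j)) ∘ σ) ∧ (∀ i, 0 < y (Sum.inr i)) ∧
    ∀ i, 0 < weightOf (fun j => y (Sum.inl j)) i}

/-- Positive coefficients make ∏x_i and ∏w_i · Δ(x)^2 positive, which forces positive nodes,
distinct nodes and positive weights. Relabelling then realizes any prescribed order. -/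
theorem exists_quadrature_ordered {r : ℕ} (σ : Equiv.Perm (Fin (r + 1))) {a : ℕ → ℝ}
    (ha : ∀ j < 2 * r + 1, 0 < a j) (hz : ∀ j, 2 * r + 1 ≤ j → a j = 0) :
    ∃ x w : Fin (r + 1) → ℝ, StrictMono (x ∘ σ) ∧ (∀ i, 0 < x i) ∧ (∀ i, 0 < w i) ∧
      (∀ k, ∑ i, w i * x i ^ k = dyck a (2 * k) 0) ∧
      ∑ i, x i = ∑ j ∈ Finset.range (2 * r + 1), a j ∧
      ∏ i, x i = ∏ i ∈ Finset.range (r + 1), a (2 * i) ∧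
      (∏ i, w i) * pairProd x = ∏ k ∈ Finset.range (r + 1), ∏ j ∈ Finset.range (2 * k), a j := by
  have ha' : ∀ j, 0 ≤ a j := fun j => by
    rcases lt_or_ge j (2 * r + 1) with h | h
    · exact (ha j h).le
    · rw [hz j h]
  obtain ⟨x, w, hx, hw, hm, hsum, hprod, hdisc⟩ := exists_quadrature r ha' (hz _ le_rfl)
  have hprod' : 0 < ∏ i, x i := by
    rw [hprod]
    exact Finset.prod_pos fun i hi => ha _ (by have := Finset.mem_range.1 hi; omega)
  have hdisc' : 0 < (∏ i, w i) * (Matrix.vandermonde x).det ^ 2 := by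
    rw [hdisc]
    exact Finset.prod_pos fun k hk => Finset.prod_pos fun j hj => ha _ (by
      have := Finset.mem_range.1 hk; have := Finset.mem_range.1 hj; omega)
  have hinj : Function.Injective x := by
    rw [← Matrix.det_vandermonde_ne_zero_iff]
    intro h
    simp [h] at hdisc'
  have hx' : ∀ i, 0 < x i := fun i => (hx i).lt_of_ne fun h =>
    hprod'.ne' (Finset.prod_eq_zero (Finset.mem_univ i) h.symm)
  have hw' : ∀ i, 0 < w i := fun i => (hw i).lt_of_ne fun h => by
    rw [Finset.prod_eq_zero (Finset.mem_univ i) h.symm, zero_mul] at hdisc'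
    exact lt_irrefl _ hdisc'
  -- Chosen so that ρ ∘ σ is the sorting permutation of x.
  set ρ : Equiv.Perm (Fin (r + 1)) := σ.symm.trans (Tuple.sort x) with hρ
  refine ⟨x ∘ ρ, w ∘ ρ, ?_, fun i => hx' _, fun i => hw' _, fun k => ?_, ?_, ?_, ?_⟩
  · have h1 : (x ∘ ρ) ∘ σ = x ∘ Tuple.sort x := by
      funext i; simp [hρ]
    rw [h1]
    exact (Tuple.monotone_sort x).strictMono_of_injective
      (hinj.comp (Tuple.sort x).injective)
  · rw [← hm k]; exact Equiv.sum_comp ρ fun i => w i * x i ^ k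
  · rw [← hsum]; exact Equiv.sum_comp ρ x
  · rw [← hprod]; exact Equiv.prod_comp ρ x
  · rw [← hdisc, pairProd_comp_equiv, det_vandermonde_sq]
    congr 1
    exact Equiv.prod_comp ρ w

theorem moments_eq_of_nodeMom_eq {r N : ℕ} (hN : N = 2 * r + 1)
    (e : Fin r ⊕ Fin (r + 1) ≃ Fin N) {x w : Fin (r + 1) → ℝ} {y : Fin r ⊕ Fin (r + 1) → ℝ}
    (hw : ∑ i, w i = 1) (h : ∀ i, nodeMom e y i = ∑ j, w j * x j ^ ((e i : ℕ) + 1)) :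
    ∀ k < 2 * (r + 1), ∑ i, weightOf (fun j => y (Sum.inl j)) i * y (Sum.inr i) ^ k =
      ∑ i, w i * x i ^ k := by
  intro k hk
  rcases Nat.eq_zero_or_pos k with rfl | hk0
  · simp [hw, sum_weightOf]
  · have := h (e.symm ⟨k - 1, by omega⟩)
    rw [nodeMom, Equiv.apply_symm_apply] at this
    simpa [Nat.sub_add_cancel hk0] using this

theorem injOn_nodeMom {r N : ℕ} (hN : N = 2 * r + 1) (e : Fin r ⊕ Fin (r + 1) ≃ Fin N)
    (σ : Equiv.Perm (Fin (r + 1))) : Set.InjOn (nodeMom e) (chamber σ) := by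
  intro y hy y' hy' h
  have hm := moments_eq_of_nodeMom_eq hN e (sum_weightOf fun j => y' (Sum.inl j))
    (fun i => congrFun h i)
  obtain ⟨h1, h2⟩ := nodes_weights_unique hy.1 hy'.1 hy.2.2 hy'.2.2 hm
  funext i
  rcases i with i | i
  · have := congrFun h2 i.castSucc
    simpa using this
  · exact congrFun h1 i

/-- In each chamber the moment vectors fill the whole region above the lower bounds, and the
symmetric functions of nodes and weights are monomials in the recursion coefficients. -/
theorem exists_chamber_of_rec {r N : ℕ} (hN : N = 2 * r + 1) (e : Fin r ⊕ Fin (r + 1) ≃ Fin N)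
    (σ : Equiv.Perm (Fin (r + 1))) {z : Fin N → ℝ} (hz : ∀ i, 0 < z i) :
    ∃ y ∈ chamber σ, nodeMom e y = momOfRec N z ∘ e ∧
      ∑ i, y (Sum.inr i) = ∑ j ∈ Finset.range (2 * r + 1), extendSeq z j ∧
      ∏ i, y (Sum.inr i) = ∏ i ∈ Finset.range (r + 1), extendSeq z (2 * i) ∧
      (∏ i, weightOf (fun j => y (Sum.inl j)) i) * pairProd (fun i => y (Sum.inr i)) =
        ∏ k ∈ Finset.range (r + 1), ∏ j ∈ Finset.range (2 * k), extendSeq z j := by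
  obtain ⟨x, w, hmono, hx, hw, hm, hsum, hprod, hdisc⟩ := exists_quadrature_ordered σ
    (a := extendSeq z) (fun j hj => extendSeq_pos hz (by omega))
    (fun j hj => by rw [extendSeq, dif_neg (by omega)])
  have hw1 : ∑ i, w i = 1 := by simpa [dyck] using hm 0
  have hwo : weightOf (fun j => w j.castSucc) = w := by
    funext i
    refine Fin.lastCases ?_ (fun i => ?_) i
    · rw [weightOf_last, ← hw1, Fin.sum_univ_castSucc]; ring
    · simp
  refine ⟨Sum.elim (fun j => w j.castSucc) x, ⟨hmono, hx, ?_⟩, ?_, hsum, hprod, ?_⟩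
  · intro i
    simp only [Sum.elim_inl, hwo, hw]
  · funext i
    simp only [nodeMom, Sum.elim_inl, Sum.elim_inr, hwo, hm, Function.comp_apply, momOfRec]
  · simp only [Sum.elim_inl, Sum.elim_inr, hwo, hdisc]

theorem nodeMom_eq_momVec {r N : ℕ} (e : Fin r ⊕ Fin (r + 1) ≃ Fin N)
    {y : Fin r ⊕ Fin (r + 1) → ℝ} (hy : ∀ i, 0 ≤ weightOf (fun j => y (Sum.inl j)) i) :
    nodeMom e y = momVec N (atomicMeasure (r + 1)
      (fun i => y (Sum.inr i), weightOf fun j => y (Sum.inl j))) ∘ e := by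
  funext i
  simp only [nodeMom, Function.comp_apply, momVec]
  rw [mom_atomicMeasure _ hy]

/-- The moment vector of y lies above all lower bounds, hence comes from some z. The quadrature
built from z in the same chamber has the same moments, so injectivity identifies it with y and its
symmetric-function identities transfer to y. -/
theorem exists_rec_of_chamber {r N : ℕ} (hN : N = 2 * r + 1) (e : Fin r ⊕ Fin (r + 1) ≃ Fin N)
    {σ : Equiv.Perm (Fin (r + 1))} {y : Fin r ⊕ Fin (r + 1) → ℝ} (hy : y ∈ chamber σ) :
    ∃ z : Fin N → ℝ, (∀ i, 0 < z i) ∧ nodeMom e y = momOfRec N z ∘ e ∧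
      ∑ i, y (Sum.inr i) = ∑ j ∈ Finset.range (2 * r + 1), extendSeq z j ∧
      ∏ i, y (Sum.inr i) = ∏ i ∈ Finset.range (r + 1), extendSeq z (2 * i) ∧
      (∏ i, weightOf (fun j => y (Sum.inl j)) i) * pairProd (fun i => y (Sum.inr i)) =
        ∏ k ∈ Finset.range (r + 1), ∏ j ∈ Finset.range (2 * k), extendSeq z j := by
  have hinj : Function.Injective fun j => y (Sum.inr j) := by
    have := hy.1.injective.comp σ.symm.injective
    rwa [Function.comp_assoc, Equiv.self_comp_symm] at this
  have hmem := momVec_atomicMeasure_mem_posRegion hinj hy.2.1 hy.2.2 (sum_weightOf _)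
  obtain rfl : N = 2 * (r + 1) - 1 := by omega
  rw [← image_momOfRec] at hmem
  obtain ⟨z, hz, hzm⟩ := hmem
  obtain ⟨y', hy', h1, h2⟩ := exists_chamber_of_rec hN e σ hz
  have h3 : nodeMom e y = momOfRec (2 * (r + 1) - 1) z ∘ e := by
    rw [nodeMom_eq_momVec e fun i => (hy.2.2 i).le, hzm]
  obtain rfl := injOn_nodeMom hN e σ hy hy' (h3.trans h1.symm)
  exact ⟨z, hz, h1, h2⟩

theorem image_nodeMom {r N : ℕ} (hN : N = 2 * r + 1) (e : Fin r ⊕ Fin (r + 1) ≃ Fin N)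
    (σ : Equiv.Perm (Fin (r + 1))) :
    nodeMom e '' chamber σ = (fun m => m ∘ e) '' posRegion N := by
  rw [← image_momOfRec, Set.image_image]
  ext u
  constructor
  · rintro ⟨y, hy, rfl⟩
    obtain ⟨z, hz, h, -⟩ := exists_rec_of_chamber hN e hy
    exact ⟨z, hz, h.symm⟩
  · rintro ⟨z, hz, rfl⟩
    obtain ⟨y, hy, h, -⟩ := exists_chamber_of_rec hN e σ hz
    exact ⟨y, hy, h⟩

/-! ### The density in the recursion coefficients -/

/-- The unnormalized density in the recursion coefficients. -/
noncomputable def recWeight (N : ℕ) (γ : ℕ → ℝ) (z : Fin N → ℝ) : ℝ :=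
  ∏ k : Fin N, z k ^ γ (k + 1) * Real.exp (-z k)

/-- The factor `a j` occurs in the inner products for k = ⌊j/2⌋ + 1, …, r, that is r - ⌊j/2⌋ times.
Indices are shifted by one, so even j correspond to the odd-numbered z, which carry the extra
exponent g. -/
theorem prod_rpow_eq (c g : ℝ) (r : ℕ) {a : ℕ → ℝ} (ha : ∀ j < 2 * r + 1, 0 < a j) :
    ∏ j ∈ Finset.range (2 * r + 1), a j ^ (c * ((r : ℝ) - (j / 2 : ℕ)) + if Even j then g else 0) =
      (∏ k ∈ Finset.range (r + 1), ∏ j ∈ Finset.range (2 * k), a j) ^ c *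
        (∏ i ∈ Finset.range (r + 1), a (2 * i)) ^ g := by
  induction r with
  | zero => simp
  | succ r ih =>
    have hr := ih fun j hj => ha j (by omega)
    have hp1 : 0 < ∏ k ∈ Finset.range (r + 1), ∏ j ∈ Finset.range (2 * k), a j :=
      Finset.prod_pos fun k hk => Finset.prod_pos fun j hj => ha _ (by
        have := Finset.mem_range.1 hk; have := Finset.mem_range.1 hj; omega)
    have hp2 : 0 < ∏ j ∈ Finset.range (2 * r + 1), a j :=
      Finset.prod_pos fun j hj => ha _ (by have := Finset.mem_range.1 hj; omega)
    have hp3 : 0 < ∏ i ∈ Finset.range (r + 1), a (2 * i) :=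
      Finset.prod_pos fun j hj => ha _ (by have := Finset.mem_range.1 hj; omega)
    have h1 := ha (2 * r + 1) (by omega)
    have h2 := ha (2 * r + 2) (by omega)
    rw [Finset.prod_range_succ (fun k => ∏ j ∈ Finset.range (2 * k), a j) (r + 1),
      Finset.prod_range_succ (fun i => a (2 * i)) (r + 1),
      show 2 * (r + 1) = 2 * r + 1 + 1 by ring, Finset.prod_range_succ _ (2 * r + 1 + 1),
      Finset.prod_range_succ _ (2 * r + 1), Finset.prod_range_succ a (2 * r + 1),
      Real.mul_rpow hp1.le (by positivity), Real.mul_rpow hp2.le h1.le,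
      Real.mul_rpow hp3.le h2.le]
    have e1 : (2 * r + 1) / 2 = r := by omega
    have e2 : (2 * r + 1 + 1) / 2 = r + 1 := by omega
    have e3 : ¬ Even (2 * r + 1) := by simp
    have e4 : Even (2 * r + 1 + 1) := ⟨r + 1, by ring⟩
    have h3 : ∏ j ∈ Finset.range (2 * r + 1),
        a j ^ (c * (((r + 1 : ℕ) : ℝ) - (j / 2 : ℕ)) + if Even j then g else 0) =
        (∏ j ∈ Finset.range (2 * r + 1), a j) ^ c * ∏ j ∈ Finset.range (2 * r + 1),
          a j ^ (c * ((r : ℝ) - (j / 2 : ℕ)) + if Even j then g else 0) := by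
      rw [← Real.finsetProd_rpow _ _ fun j hj =>
        (ha j (by have := Finset.mem_range.1 hj; omega)).le, ← Finset.prod_mul_distrib]
      refine Finset.prod_congr rfl fun j hj => ?_
      rw [← Real.rpow_add (ha j (by have := Finset.mem_range.1 hj; omega))]
      congr 1
      push_cast
      ring
    rw [h3, hr, e1, e2, if_neg e3, if_pos e4]
    have e5 : c * (((r + 1 : ℕ) : ℝ) - (r : ℕ)) + 0 = c := by push_cast; ring
    have e6 : c * (((r + 1 : ℕ) : ℝ) - ((r + 1 : ℕ) : ℝ)) + g = g := by ring
    rw [e5, e6]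
    ring

theorem recWeight_eq {r N : ℕ} (hN : N = 2 * r + 1) (c g : ℝ) {γ : ℕ → ℝ}
    (hγ : ∀ j < N, γ (j + 1) = c * ((r : ℝ) - (j / 2 : ℕ)) + if Even j then g else 0)
    {z : Fin N → ℝ} (hz : ∀ i, 0 < z i) :
    recWeight N γ z =
      (∏ k ∈ Finset.range (r + 1), ∏ j ∈ Finset.range (2 * k), extendSeq z j) ^ c *
        (∏ i ∈ Finset.range (r + 1), extendSeq z (2 * i)) ^ g *
        Real.exp (-∑ j ∈ Finset.range (2 * r + 1), extendSeq z j) := by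
  rw [← prod_rpow_eq c g r fun j hj => extendSeq_pos hz (by omega), ← hN,
    ← Finset.sum_neg_distrib, Real.exp_sum, ← Finset.prod_mul_distrib, recWeight,
    ← Fin.prod_univ_eq_prod_range]
  refine Finset.prod_congr rfl fun k _ => ?_
  rw [hγ k k.2]
  simp [extendSeq]

/-- With P = ∏w_i and Q = Δ^2, the splitting Q^{β/2} P^{β/2-1} = (P Q^2)(P Q)^{β/2-2} separates the
Jacobian from a monomial in the recursion coefficients. -/
theorem weight_chamber_eq {r N : ℕ} (hN : N = 2 * r + 1) (e : Fin r ⊕ Fin (r + 1) ≃ Fin N)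
    {σ : Equiv.Perm (Fin (r + 1))} {y : Fin r ⊕ Fin (r + 1) → ℝ} (hy : y ∈ chamber σ)
    (β g : ℝ) {γ : ℕ → ℝ}
    (hγ : ∀ j < N, γ (j + 1) = (β / 2 - 2) * ((r : ℝ) - (j / 2 : ℕ)) + if Even j then g else 0) :
    laguerreWeight (r + 1) β g (fun i => y (Sum.inr i)) *
        dirichletDensity (r + 1) β (weightOf fun j => y (Sum.inl j)) =
      |(nodeMomDeriv e y).det| * (Real.Gamma (((r + 1 : ℕ) : ℝ) * β / 2) /
        Real.Gamma (β / 2) ^ (r + 1) *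
        recWeight N γ fun i => zCoord (nodeMom e y ∘ e.symm) (i + 1)) := by
  obtain ⟨z, hz, hm, hsum, hprod, hdisc⟩ := exists_rec_of_chamber hN e hy
  have hm' : nodeMom e y ∘ e.symm = momOfRec N z := by
    rw [hm, Function.comp_assoc, Equiv.self_comp_symm, Function.comp_id]
  have hzz : (fun i : Fin N => zCoord (nodeMom e y ∘ e.symm) (i + 1)) = z := by
    funext i
    rw [hm', zCoord_momOfRec hz]
  rw [hzz, recWeight_eq hN _ g hγ hz, ← hsum, ← hprod, ← hdisc, det_nodeMomDeriv]
  set x : Fin (r + 1) → ℝ := fun i => y (Sum.inr i) with hx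
  set w : Fin (r + 1) → ℝ := weightOf fun j => y (Sum.inl j) with hw
  have hx0 : ∀ i, 0 < x i := hy.2.1
  have hw0 : ∀ i, 0 < w i := hy.2.2
  have hP : 0 < ∏ i, w i := Finset.prod_pos fun i _ => hw0 i
  have hinj : Function.Injective x := by
    have := hy.1.injective.comp σ.symm.injective
    rwa [Function.comp_assoc, Equiv.self_comp_symm] at this
  have hQ : 0 < pairProd x := by
    rw [← det_vandermonde_sq]
    have := Matrix.det_vandermonde_ne_zero_iff.2 hinj
    positivity
  have h1 : laguerreWeight (r + 1) β g x =
      pairProd x ^ (β / 2) * ((∏ i, x i) ^ g * Real.exp (-∑ i, x i)) := by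
    rw [laguerreWeight, ← Matrix.det_vandermonde, ← det_vandermonde_sq, ← sq_abs,
      ← Real.rpow_natCast, ← Real.rpow_mul (abs_nonneg _), ← Finset.sum_neg_distrib,
      Real.exp_sum, ← Real.finsetProd_rpow _ _ fun i _ => (hx0 i).le, ← Finset.prod_mul_distrib]
    congr 1
    · congr 1; push_cast; ring
    · exact Finset.prod_congr rfl fun i _ => by rw [if_pos (hx0 i), mul_one]
  have h2 : dirichletDensity (r + 1) β w = Real.Gamma (((r + 1 : ℕ) : ℝ) * β / 2) /
        Real.Gamma (β / 2) ^ (r + 1) * (∏ i, w i) ^ (β / 2 - 1) := by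
    rw [dirichletDensity, if_pos ⟨hw0, sum_weightOf _⟩, mul_one,
      ← Real.finsetProd_rpow _ _ fun i _ => (hw0 i).le]
  rw [h1, h2, abs_of_pos hP, Real.mul_rpow hP.le hQ.le]
  have h3 : pairProd x ^ (β / 2) = pairProd x ^ (β / 2 - 2) * pairProd x ^ 2 := by
    rw [← Real.rpow_natCast, ← Real.rpow_add hQ]
    congr 1; push_cast; ring
  have h4 : (∏ i, w i) ^ (β / 2 - 1) = (∏ i, w i) ^ (β / 2 - 2) * ∏ i, w i := by
    nth_rewrite 3 [← Real.rpow_one (∏ i, w i)]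
    rw [← Real.rpow_add hP]
    congr 1; ring
  rw [h3, h4]
  ring

/-! ### Gamma and Dirichlet integrals -/

open scoped ENNReal

theorem lintegral_fin_succ {r : ℕ} {f : (Fin (r + 1) → ℝ) → ℝ≥0∞} (hf : Measurable f) :
    ∫⁻ z, f z = ∫⁻ x : ℝ, ∫⁻ p : Fin r → ℝ, f (Fin.cons x p) := by
  have hmp := (volume_preserving_piFinSuccAbove (fun _ : Fin (r + 1) => ℝ) 0).symm
  rw [← hmp.lintegral_comp_emb (MeasurableEquiv.measurableEmbedding _), Measure.volume_eq_prod,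
    lintegral_prod _ (by fun_prop)]
  simp only [MeasurableEquiv.piFinSuccAbove_symm_apply]
  refine lintegral_congr fun x => lintegral_congr fun p => ?_
  simp [Fin.insertNthEquiv]

theorem lintegral_prod_fin {N : ℕ} {f : Fin N → ℝ → ℝ≥0∞} (hf : ∀ i, Measurable (f i)) :
    ∫⁻ z : Fin N → ℝ, ∏ i, f i (z i) = ∏ i, ∫⁻ x, f i x := by
  induction N with
  | zero => simp [volume_pi]
  | succ N ih =>
    have hm : ∀ {n : ℕ} {g : Fin n → ℝ → ℝ≥0∞}, (∀ i, Measurable (g i)) →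
        Measurable fun z : Fin n → ℝ => ∏ i, g i (z i) := fun hg =>
      Finset.measurable_prod _ fun i _ => (hg i).comp (measurable_pi_apply i)
    rw [lintegral_fin_succ (hm hf)]
    simp only [Fin.prod_univ_succ, Fin.cons_zero, Fin.cons_succ]
    have : ∀ x, ∫⁻ p : Fin N → ℝ, f 0 x * ∏ i : Fin N, f i.succ (p i) =
        f 0 x * ∏ i : Fin N, ∫⁻ x, f i.succ x := fun x => by
      rw [lintegral_const_mul _ (hm fun i => hf _), ih fun i => hf _]
    simp only [this]
    rw [lintegral_mul_const _ (hf 0)]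

/-- The power function `x ^ (a - 1)` on the positive half line, extended by zero. -/
noncomputable def halfPow (a x : ℝ) : ℝ≥0∞ := if 0 < x then ENNReal.ofReal (x ^ (a - 1)) else 0

@[fun_prop]
theorem measurable_halfPow (a : ℝ) : Measurable (halfPow a) :=
  Measurable.ite measurableSet_Ioi (by fun_prop) measurable_const

theorem lintegral_halfPow_mul_one_sub {a c : ℝ} (ha : 0 < a) (hc : 0 < c) :
    ∫⁻ t, halfPow a t * halfPow c (1 - t) = ENNReal.ofReal (beta a c) := by
  have hb := beta_pos ha hc
  have h : ∀ t, halfPow a t * halfPow c (1 - t) =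
      ENNReal.ofReal (beta a c) * betaPDF a c t := by
    intro t
    rw [betaPDF_eq, halfPow, halfPow]
    by_cases h0 : 0 < t <;> by_cases h1 : t < 1
    · have h1' : 0 < 1 - t := by linarith
      rw [if_pos h0, if_pos h1', if_pos ⟨h0, h1⟩, ← ENNReal.ofReal_mul (by positivity),
        ← ENNReal.ofReal_mul hb.le]
      congr 1
      field_simp
    · rw [if_neg (c := 0 < 1 - t) (by linarith), if_neg (c := 0 < t ∧ t < 1) (by tauto)]; simp
    · rw [if_neg (c := 0 < t) h0, if_neg (c := 0 < t ∧ t < 1) (by tauto)]; simp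
    · rw [if_neg (c := 0 < t) h0, if_neg (c := 0 < t ∧ t < 1) (by tauto)]; simp
  simp only [h]
  rw [lintegral_const_mul _ (by unfold betaPDF; fun_prop), lintegral_betaPDF_eq_one ha hc, mul_one]

/-- For s > 0 the substitution x = st reduces the convolution to the Beta integral; for s ≤ 0 one
factor always vanishes. -/
theorem halfPow_convolution {a c : ℝ} (ha : 0 < a) (hc : 0 < c) (s : ℝ) :
    ∫⁻ x, halfPow a x * halfPow c (s - x) = ENNReal.ofReal (beta a c) * halfPow (a + c) s := by
  by_cases hs : 0 < s
  · have hm : Measurable fun x => halfPow a x * halfPow c (s - x) :=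
      (measurable_halfPow a).mul ((measurable_halfPow c).comp (by fun_prop))
    have hscale : ∀ t, halfPow a (s * t) * halfPow c (s - s * t) =
        ENNReal.ofReal (s ^ (a + c - 2)) * (halfPow a t * halfPow c (1 - t)) := by
      intro t
      simp only [halfPow, show s - s * t = s * (1 - t) by ring, mul_pos_iff_of_pos_left hs]
      split_ifs with h1 h2
      · rw [← ENNReal.ofReal_mul (by positivity), ← ENNReal.ofReal_mul (by positivity),
          ← ENNReal.ofReal_mul (by positivity), Real.mul_rpow hs.le h1.le,
          Real.mul_rpow hs.le h2.le, show a + c - 2 = (a - 1) + (c - 1) by ring,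
          Real.rpow_add hs]
        congr 1; ring
      all_goals simp
    rw [← Real.smul_map_volume_mul_left hs.ne', lintegral_smul_measure,
      lintegral_map hm (by fun_prop)]
    simp only [hscale]
    rw [lintegral_const_mul _ (by fun_prop), lintegral_halfPow_mul_one_sub ha hc,
      smul_eq_mul, ← mul_assoc, ← ENNReal.ofReal_mul (abs_nonneg _), mul_comm, abs_of_pos hs,
      halfPow, if_pos hs]
    congr 2
    nth_rewrite 1 [← Real.rpow_one s]
    rw [← Real.rpow_add hs]
    congr 1; ring
  · have : ∀ x, halfPow a x * halfPow c (s - x) = 0 := by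
      intro x
      unfold halfPow
      by_cases hx : 0 < x
      · rw [if_neg (c := 0 < s - x) (by linarith), mul_zero]
      · rw [if_neg hx, zero_mul]
    simp only [this]
    simp [halfPow, hs]

/-- Integrating out one coordinate at a time is a convolution of powers. The total s is kept free
because the induction applies the formula at s - x. -/
theorem lintegral_dirichlet {b c : ℝ} (hb : 0 < b) (hc : 0 < c) (r : ℕ) (s : ℝ) :
    ∫⁻ p : Fin r → ℝ, (∏ i, halfPow b (p i)) * halfPow c (s - ∑ i, p i) =
      ENNReal.ofReal (Real.Gamma b ^ r * Real.Gamma c / Real.Gamma (r * b + c)) *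
        halfPow (r * b + c) s := by
  induction r generalizing s with
  | zero => simp [volume_pi, (Real.Gamma_pos_of_pos hc).ne']
  | succ r ih =>
    have hrb : 0 < r * b + c := by positivity
    have hm : ∀ {r : ℕ} (s : ℝ), Measurable fun p : Fin r → ℝ =>
        (∏ i, halfPow b (p i)) * halfPow c (s - ∑ i, p i) := fun s =>
      (Finset.measurable_prod _ fun i _ => (measurable_halfPow b).comp (measurable_pi_apply i)).mul
        ((measurable_halfPow c).comp (by fun_prop))
    rw [lintegral_fin_succ (hm s)]
    simp only [Fin.prod_univ_succ, Fin.sum_univ_succ, Fin.cons_zero, Fin.cons_succ, mul_assoc,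
      ← sub_sub]
    have h : ∀ x, ∫⁻ p : Fin r → ℝ, halfPow b x *
        ((∏ i, halfPow b (p i)) * halfPow c (s - x - ∑ i, p i)) =
        ENNReal.ofReal (Real.Gamma b ^ r * Real.Gamma c / Real.Gamma (r * b + c)) *
          (halfPow b x * halfPow (r * b + c) (s - x)) := fun x => by
      rw [lintegral_const_mul _ (hm _), ih]; ring
    simp only [h]
    rw [lintegral_const_mul _ (by fun_prop), halfPow_convolution hb hrb, ← mul_assoc,
      ← ENNReal.ofReal_mul (by
        have := Real.Gamma_pos_of_pos hb
        have := Real.Gamma_pos_of_pos hc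
        have := Real.Gamma_pos_of_pos hrb
        positivity)]
    have e1 : b + (r * b + c) = ((r + 1 : ℕ) : ℝ) * b + c := by push_cast; ring
    rw [beta, e1]
    congr 2
    have := (Real.Gamma_pos_of_pos hrb).ne'
    field_simp
    ring

theorem ofReal_dirichletDensity {r : ℕ} {β : ℝ} (hβ : 0 < β) (p : Fin r → ℝ) :
    ENNReal.ofReal (dirichletDensity (r + 1) β (weightOf p)) =
      ENNReal.ofReal (Real.Gamma (((r + 1 : ℕ) : ℝ) * β / 2) / Real.Gamma (β / 2) ^ (r + 1)) *
        ((∏ i, halfPow (β / 2) (p i)) * halfPow (β / 2) (1 - ∑ i, p i)) := by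
  have hG : 0 ≤ Real.Gamma (((r + 1 : ℕ) : ℝ) * β / 2) / Real.Gamma (β / 2) ^ (r + 1) := by
    have h1 := Real.Gamma_pos_of_pos (s := ((r + 1 : ℕ) : ℝ) * β / 2) (by positivity)
    have h2 := Real.Gamma_pos_of_pos (s := β / 2) (by positivity)
    positivity
  have hprod : (∏ i, halfPow (β / 2) (p i)) * halfPow (β / 2) (1 - ∑ i, p i) =
      ∏ i, halfPow (β / 2) (weightOf p i) := by
    rw [Fin.prod_univ_castSucc]; simp
  rw [hprod, dirichletDensity]
  by_cases h : ∀ i, 0 < weightOf p i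
  · rw [if_pos ⟨h, sum_weightOf p⟩, mul_one, ENNReal.ofReal_mul hG,
      ENNReal.ofReal_prod_of_nonneg fun i _ => Real.rpow_nonneg (h i).le _]
    congr 1
    exact Finset.prod_congr rfl fun i _ => by rw [halfPow, if_pos (h i)]
  · rw [if_neg fun h' => h h'.1]
    push Not at h
    obtain ⟨i, hi⟩ := h
    rw [Finset.prod_eq_zero (f := fun i => halfPow (β / 2) (weightOf p i)) (Finset.mem_univ i)
      (by rw [halfPow, if_neg hi.not_gt])]
    simp

theorem lintegral_dirichletDensity {r : ℕ} {β : ℝ} (hβ : 0 < β) :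
    ∫⁻ p : Fin r → ℝ, ENNReal.ofReal (dirichletDensity (r + 1) β (weightOf p)) = 1 := by
  have hb : 0 < β / 2 := by positivity
  simp only [ofReal_dirichletDensity hβ]
  rw [lintegral_const_mul _ (by fun_prop), lintegral_dirichlet hb hb]
  have e1 : (r : ℝ) * (β / 2) + β / 2 = ((r + 1 : ℕ) : ℝ) * β / 2 := by push_cast; ring
  have h1 := Real.Gamma_pos_of_pos (s := ((r + 1 : ℕ) : ℝ) * β / 2) (by positivity)
  have h2 := Real.Gamma_pos_of_pos hb
  rw [e1, halfPow, if_pos one_pos, Real.one_rpow, ENNReal.ofReal_one, mul_one,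
    ← ENNReal.ofReal_mul (by positivity), ENNReal.ofReal_eq_one]
  field_simp
  ring

theorem lintegral_rpow_mul_exp {s : ℝ} (hs : 0 < s) :
    ∫⁻ x in Set.Ioi (0 : ℝ), ENNReal.ofReal (x ^ (s - 1) * Real.exp (-x)) =
      ENNReal.ofReal (Real.Gamma s) := by
  rw [Real.Gamma_eq_integral hs, ofReal_integral_eq_lintegral_ofReal]
  · exact lintegral_congr fun x => by rw [mul_comm]
  · exact Real.GammaIntegral_convergent hs
  · filter_upwards [ae_restrict_mem measurableSet_Ioi] with x hx
    have : (0 : ℝ) < x := hx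
    positivity

/-! ### Integration in the coordinates of the moment space -/

/-- The recursion coefficients of a moment vector. -/
noncomputable def recOfMom {N : ℕ} (m : Fin N → ℝ) : Fin N → ℝ := fun i => zCoord m (i + 1)

theorem recOfMom_momOfRec {N : ℕ} {z : Fin N → ℝ} (hz : ∀ i, 0 < z i) :
    recOfMom (momOfRec N z) = z :=
  funext fun i => zCoord_momOfRec hz i

theorem measurableSet_pos (N : ℕ) : MeasurableSet {z : Fin N → ℝ | ∀ i, 0 < z i} := by
  simp only [Set.ofPred_forall]
  exact MeasurableSet.iInter fun i => measurableSet_lt measurable_const (measurable_pi_apply i)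

theorem prod_prod_range (a : ℕ → ℝ) (N : ℕ) :
    ∏ k ∈ Finset.range N, ∏ j ∈ Finset.range k, a j =
      ∏ j ∈ Finset.range N, a j ^ (N - 1 - j) := by
  induction N with
  | zero => simp
  | succ N ih =>
    rw [Finset.prod_range_succ, ih, Finset.prod_range_succ _ N, ← Finset.prod_mul_distrib]
    simp only [Nat.add_sub_cancel, Nat.sub_self, pow_zero, mul_one]
    refine Finset.prod_congr rfl fun j hj => ?_
    rw [← pow_succ]
    congr 1
    have := Finset.mem_range.1 hj
    omega

/-- In recursion coordinates the Jacobian is itself a monomial, raising the exponent of the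
zero-based coordinate k by N - 1 - k, so the integral factors into Gamma integrals. -/
theorem lintegral_recWeight {N : ℕ} {γ : ℕ → ℝ}
    (hγ : ∀ k : Fin N, 0 < γ (k + 1) + N - (k : ℕ)) :
    ∫⁻ m in posRegion N, ENNReal.ofReal (recWeight N γ (recOfMom m)) =
      ENNReal.ofReal (∏ k : Fin N, Real.Gamma (γ (k + 1) + N - (k : ℕ))) := by
  rw [← image_momOfRec, lintegral_image_eq_lintegral_abs_det_fderiv_mul volume
    (measurableSet_pos N)
    (fun z _ => (differentiable_momOfRec N z).hasFDerivAt.hasFDerivWithinAt) (injOn_momOfRec N)]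
  have h1 : ∀ z ∈ {z : Fin N → ℝ | ∀ i, 0 < z i},
      ENNReal.ofReal |(fderiv ℝ (momOfRec N) z).det| *
        ENNReal.ofReal (recWeight N γ (recOfMom (momOfRec N z))) =
      ∏ k : Fin N, (Set.Ioi 0).indicator
        (fun x => ENNReal.ofReal (x ^ (γ (k + 1) + N - (k : ℕ) - 1) * Real.exp (-x))) (z k) := by
    intro z hz
    have hdet : (fderiv ℝ (momOfRec N) z).det = ∏ k : Fin N, z k ^ (N - 1 - (k : ℕ)) := by
      rw [det_fderiv_momOfRec, Fin.prod_univ_eq_prod_range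
        (fun k => ∏ j ∈ Finset.range k, extendSeq z j), prod_prod_range,
        ← Fin.prod_univ_eq_prod_range]
      exact Finset.prod_congr rfl fun k _ => by simp [extendSeq]
    have hz' : ∀ i, 0 < z i := hz
    rw [hdet, abs_of_nonneg (Finset.prod_nonneg fun i _ => pow_nonneg (hz' i).le _),
      recOfMom_momOfRec hz, recWeight, ← ENNReal.ofReal_mul
      (Finset.prod_nonneg fun i _ => pow_nonneg (hz' i).le _), ← Finset.prod_mul_distrib,
      ENNReal.ofReal_prod_of_nonneg fun i _ => by have := hz' i; positivity]
    refine Finset.prod_congr rfl fun k _ => ?_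
    rw [Set.indicator_of_mem (by exact hz' k), ← mul_assoc, ← Real.rpow_natCast,
      ← Real.rpow_add (hz' k)]
    congr 3
    have := k.2
    rw [Nat.cast_sub (by omega), Nat.cast_sub (by omega)]
    push_cast; ring
  have h2 : ∀ z, (∏ k : Fin N, (Set.Ioi 0).indicator
        (fun x => ENNReal.ofReal (x ^ (γ (k + 1) + N - (k : ℕ) - 1) * Real.exp (-x))) (z k)) =
      {z : Fin N → ℝ | ∀ i, 0 < z i}.indicator (fun z => ∏ k : Fin N, (Set.Ioi 0).indicator
        (fun x => ENNReal.ofReal (x ^ (γ (k + 1) + N - (k : ℕ) - 1) * Real.exp (-x))) (z k)) z := by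
    intro z
    by_cases hz : z ∈ {z : Fin N → ℝ | ∀ i, 0 < z i}
    · rw [Set.indicator_of_mem hz]
    · rw [Set.indicator_of_notMem hz]
      simp only [Set.mem_ofPred_eq, not_forall] at hz
      obtain ⟨i, hi⟩ := hz
      exact Finset.prod_eq_zero (Finset.mem_univ i) (Set.indicator_of_notMem hi _)
  rw [setLIntegral_congr_fun (measurableSet_pos N) h1, ← lintegral_indicator (measurableSet_pos N),
    ← lintegral_congr h2, lintegral_prod_fin (f := fun k => (Set.Ioi 0).indicator
        (fun x => ENNReal.ofReal (x ^ (γ (k + 1) + N - (k : ℕ) - 1) * Real.exp (-x))))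
      fun k => Measurable.indicator (by fun_prop) measurableSet_Ioi,
    ENNReal.ofReal_prod_of_nonneg fun k _ => (Real.Gamma_pos_of_pos (hγ k)).le]
  refine Finset.prod_congr rfl fun k _ => ?_
  rw [lintegral_indicator measurableSet_Ioi, lintegral_rpow_mul_exp (hγ k)]

theorem measurable_weightOf (r : ℕ) : Measurable (weightOf : (Fin r → ℝ) → Fin (r + 1) → ℝ) := by
  refine measurable_pi_lambda _ fun i => ?_
  refine Fin.lastCases ?_ (fun i => ?_) i
  · simp only [weightOf_last]; fun_prop
  · simp only [weightOf_castSucc]; fun_prop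

theorem measurableSet_chamber {r : ℕ} (σ : Equiv.Perm (Fin (r + 1))) :
    MeasurableSet (chamber σ) := by
  have hw : ∀ i, Measurable fun y : Fin r ⊕ Fin (r + 1) → ℝ =>
      weightOf (fun j => y (Sum.inl j)) i := fun i =>
    (measurable_pi_apply i).comp ((measurable_weightOf r).comp
      (measurable_pi_lambda _ fun j => measurable_pi_apply _))
  simp only [chamber, StrictMono, Set.ofPred_and, Set.ofPred_forall, Function.comp_apply]
  refine MeasurableSet.inter ?_ (MeasurableSet.inter ?_ ?_)
  · exact MeasurableSet.iInter fun i => MeasurableSet.iInter fun j => MeasurableSet.iInter fun _ =>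
      measurableSet_lt (measurable_pi_apply _) (measurable_pi_apply _)
  · exact MeasurableSet.iInter fun i => measurableSet_lt measurable_const (measurable_pi_apply _)
  · exact MeasurableSet.iInter fun i => measurableSet_lt measurable_const (hw i)

theorem measurePreserving_comp_equiv {ι κ : Type*} [Fintype ι] [Fintype κ] (e : ι ≃ κ) :
    MeasurePreserving (fun (m : κ → ℝ) => m ∘ e) ∧
      MeasurableEmbedding (fun (m : κ → ℝ) => m ∘ e) := by
  have h : (fun (m : κ → ℝ) => m ∘ e) = MeasurableEquiv.piCongrLeft (fun _ => ℝ) e.symm := by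
    funext m i
    obtain ⟨k, rfl⟩ := e.symm.surjective i
    rw [MeasurableEquiv.coe_piCongrLeft, Equiv.piCongrLeft_apply_apply]
    simp
  rw [h]
  exact ⟨volume_measurePreserving_piCongrLeft _ _, MeasurableEquiv.measurableEmbedding _⟩

/-- The right side does not depend on σ, so all orderings contribute equally. The function φ needs
no measurability, since change of variables along injective maps holds for arbitrary nonnegative
integrands. -/
theorem lintegral_chamber {r N : ℕ} (hN : N = 2 * r + 1) (e : Fin r ⊕ Fin (r + 1) ≃ Fin N)
    (σ : Equiv.Perm (Fin (r + 1))) {β : ℝ} (hβ : 0 < β) (g : ℝ) {γ : ℕ → ℝ}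
    (hγ : ∀ j < N, γ (j + 1) = (β / 2 - 2) * ((r : ℝ) - (j / 2 : ℕ)) + if Even j then g else 0)
    (φ : (Fin N → ℝ) → ℝ≥0∞) :
    ∫⁻ y in chamber σ, ENNReal.ofReal (laguerreWeight (r + 1) β g (fun i => y (Sum.inr i))) *
        ENNReal.ofReal (dirichletDensity (r + 1) β (weightOf fun j => y (Sum.inl j))) *
        φ (nodeMom e y ∘ e.symm) =
      ∫⁻ m in posRegion N, ENNReal.ofReal (Real.Gamma (((r + 1 : ℕ) : ℝ) * β / 2) /
        Real.Gamma (β / 2) ^ (r + 1)) * (ENNReal.ofReal (recWeight N γ (recOfMom m)) * φ m) := by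
  obtain ⟨hmp, hemb⟩ := measurePreserving_comp_equiv e
  have hcomp : ∀ m : Fin N → ℝ, (m ∘ e) ∘ e.symm = m := fun m => by
    rw [Function.comp_assoc, Equiv.self_comp_symm, Function.comp_id]
  set ψ : (Fin r ⊕ Fin (r + 1) → ℝ) → ℝ≥0∞ := fun u =>
    ENNReal.ofReal (Real.Gamma (((r + 1 : ℕ) : ℝ) * β / 2) / Real.Gamma (β / 2) ^ (r + 1)) *
      (ENNReal.ofReal (recWeight N γ (recOfMom (u ∘ e.symm))) * φ (u ∘ e.symm)) with hψ
  have hR : ∀ m : Fin N → ℝ, ENNReal.ofReal (Real.Gamma (((r + 1 : ℕ) : ℝ) * β / 2) /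
        Real.Gamma (β / 2) ^ (r + 1)) * (ENNReal.ofReal (recWeight N γ (recOfMom m)) * φ m) =
      ψ (m ∘ e) := fun m => by simp only [hψ, hcomp]
  simp only [hR]
  rw [hmp.setLIntegral_comp_emb hemb, ← image_nodeMom hN e σ,
    lintegral_image_eq_lintegral_abs_det_fderiv_mul volume (measurableSet_chamber σ)
      (fun y _ => (hasFDerivAt_nodeMom e y).hasFDerivWithinAt) (injOn_nodeMom hN e σ)]
  refine setLIntegral_congr_fun (measurableSet_chamber σ) fun y hy => ?_
  have hL : 0 ≤ laguerreWeight (r + 1) β g fun i => y (Sum.inr i) := by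
    refine mul_nonneg (by positivity) (Finset.prod_nonneg fun i _ => ?_)
    have : 0 < y (Sum.inr i) := hy.2.1 i
    split_ifs <;> positivity
  have hG : 0 ≤ Real.Gamma (((r + 1 : ℕ) : ℝ) * β / 2) / Real.Gamma (β / 2) ^ (r + 1) := by
    have h1 := Real.Gamma_pos_of_pos (s := ((r + 1 : ℕ) : ℝ) * β / 2) (by positivity)
    have h2 := Real.Gamma_pos_of_pos (s := β / 2) (by positivity)
    positivity
  have hdet : (Matrix.toLin' (nodeMomDeriv e y)).toContinuousLinearMap.det =
      (nodeMomDeriv e y).det := by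
    rw [ContinuousLinearMap.det, LinearMap.coe_toContinuousLinearMap, LinearMap.det_toLin']
  simp only [hψ]
  rw [← ENNReal.ofReal_mul hL, weight_chamber_eq hN e hy β g hγ,
    ENNReal.ofReal_mul (abs_nonneg _), ENNReal.ofReal_mul hG, hdet]
  simp only [mul_assoc]
  rfl

theorem laguerreWeight_eq_zero {n : ℕ} {β : ℝ} (hβ : 0 < β) (g : ℝ) {x : Fin n → ℝ}
    (hx : ¬(Function.Injective x ∧ ∀ i, 0 < x i)) : laguerreWeight n β g x = 0 := by
  rw [laguerreWeight]
  by_cases h : Function.Injective x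
  · have h' : ¬∀ i, 0 < x i := fun h' => hx ⟨h, h'⟩
    push Not at h'
    obtain ⟨i, hi⟩ := h'
    refine mul_eq_zero_of_right _ (Finset.prod_eq_zero (Finset.mem_univ i) ?_)
    rw [if_neg hi.not_gt, mul_zero]
  · rw [← Matrix.det_vandermonde_ne_zero_iff, not_not] at h
    rw [← Matrix.det_vandermonde, h, abs_zero, Real.zero_rpow hβ.ne', zero_mul]

theorem pairwise_disjoint_chamber (r : ℕ) :
    Pairwise (Function.onFun Disjoint (chamber : Equiv.Perm (Fin (r + 1)) → _)) := by
  intro σ τ hστ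
  rw [Function.onFun, Set.disjoint_left]
  rintro y ⟨h1, -⟩ ⟨h2, -⟩
  refine hστ ?_
  have hr : Set.range ((fun j => y (Sum.inr j)) ∘ σ) = Set.range ((fun j => y (Sum.inr j)) ∘ τ) := by
    rw [σ.surjective.range_comp, τ.surjective.range_comp]
  have h3 := (StrictMono.range_inj h1 h2).1 hr
  have hinj : Function.Injective fun j => y (Sum.inr j) := by
    have := h1.injective.comp σ.symm.injective
    rwa [Function.comp_assoc, Equiv.self_comp_symm] at this
  exact Equiv.ext fun i => hinj (congrFun h3 i)

theorem lintegral_nodes_weights {r N : ℕ} (hN : N = 2 * r + 1)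
    (e : Fin r ⊕ Fin (r + 1) ≃ Fin N) {β : ℝ} (hβ : 0 < β) (g : ℝ) {γ : ℕ → ℝ}
    (hγ : ∀ j < N, γ (j + 1) = (β / 2 - 2) * ((r : ℝ) - (j / 2 : ℕ)) + if Even j then g else 0)
    (φ : (Fin N → ℝ) → ℝ≥0∞) :
    ∫⁻ q : (Fin (r + 1) → ℝ) × (Fin r → ℝ), ENNReal.ofReal (laguerreWeight (r + 1) β g q.1) *
        ENNReal.ofReal (dirichletDensity (r + 1) β (weightOf q.2)) *
        φ (momVec N (atomicMeasure (r + 1) (q.1, weightOf q.2))) =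
      ((r + 1).factorial : ℝ≥0∞) *
      ∫⁻ m in posRegion N, ENNReal.ofReal (Real.Gamma (((r + 1 : ℕ) : ℝ) * β / 2) /
        Real.Gamma (β / 2) ^ (r + 1)) * (ENNReal.ofReal (recWeight N γ (recOfMom m)) * φ m) := by
  have hmp := (Measure.measurePreserving_swap (μ := (volume : Measure (Fin r → ℝ)))
    (ν := (volume : Measure (Fin (r + 1) → ℝ)))).comp
    (volume_measurePreserving_sumPiEquivProdPi fun _ : Fin r ⊕ Fin (r + 1) => ℝ)
  have hemb := (MeasurableEquiv.prodComm (α := Fin r → ℝ)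
    (β := Fin (r + 1) → ℝ)).measurableEmbedding.comp
    (MeasurableEquiv.sumPiEquivProdPi fun _ : Fin r ⊕ Fin (r + 1) => ℝ).measurableEmbedding
  rw [Measure.volume_eq_prod, ← hmp.lintegral_comp_emb hemb]
  set F : (Fin r ⊕ Fin (r + 1) → ℝ) → ℝ≥0∞ := fun y =>
    ENNReal.ofReal (laguerreWeight (r + 1) β g (fun i => y (Sum.inr i))) *
        ENNReal.ofReal (dirichletDensity (r + 1) β (weightOf fun j => y (Sum.inl j))) *
        φ (nodeMom e y ∘ e.symm) with hF
  -- Outside the chambers the integrand is zero: coinciding nodes are killed by |Δ|^β since β > 0,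
  -- nonpositive nodes or weights by the indicators.
  have h1 : ∀ y : Fin r ⊕ Fin (r + 1) → ℝ,
      ENNReal.ofReal (laguerreWeight (r + 1) β g (fun i => y (Sum.inr i))) *
        ENNReal.ofReal (dirichletDensity (r + 1) β (weightOf fun j => y (Sum.inl j))) *
        φ (momVec N (atomicMeasure (r + 1)
          (fun i => y (Sum.inr i), weightOf fun j => y (Sum.inl j)))) =
      (⋃ σ : Equiv.Perm (Fin (r + 1)), chamber σ).indicator F y := by
    intro y
    classical
    by_cases hw : ∀ i, 0 < weightOf (fun j => y (Sum.inl j)) i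
    · by_cases hx : Function.Injective (fun i => y (Sum.inr i)) ∧ ∀ i, 0 < y (Sum.inr i)
      · rw [Set.indicator_of_mem]
        · simp only [hF]
          rw [nodeMom_eq_momVec e fun i => (hw i).le, Function.comp_assoc, Equiv.self_comp_symm,
            Function.comp_id]
        · exact Set.mem_iUnion.2 ⟨Tuple.sort fun i => y (Sum.inr i),
            (Tuple.monotone_sort _).strictMono_of_injective
              (hx.1.comp (Tuple.sort _).injective), hx.2, hw⟩
      · rw [Set.indicator_apply]
        simp only [hF]
        rw [laguerreWeight_eq_zero hβ g hx]
        simp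
    · rw [Set.indicator_apply]
      simp only [hF]
      rw [dirichletDensity, if_neg fun h => hw h.1]
      simp
  refine (lintegral_congr h1).trans ?_
  rw [lintegral_indicator (MeasurableSet.iUnion fun σ => measurableSet_chamber σ),
    lintegral_iUnion measurableSet_chamber (pairwise_disjoint_chamber r)]
  simp only [hF, lintegral_chamber hN e _ hβ g hγ φ]
  rw [tsum_fintype, Finset.sum_const, Finset.card_univ, Fintype.card_perm, Fintype.card_fin,
    nsmul_eq_mul]

/-! ### The density on the moment space -/

theorem prod_Icc_one {M : Type*} [CommMonoid M] (f : ℕ → M) (N : ℕ) :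
    ∏ k ∈ Finset.Icc 1 N, f k = ∏ i : Fin N, f (i + 1) := by
  induction N with
  | zero => simp
  | succ N ih => rw [Finset.prod_Icc_succ_top (by omega), ih, Fin.prod_univ_castSucc]; simp

theorem halfLineDensity_of_mem {N : ℕ} {γ δ : ℕ → ℝ} (hδ : ∀ k ∈ Finset.Icc 1 N, δ k = 1)
    {m : Fin N → ℝ} (hm : m ∈ posRegion N) :
    halfLineDensity N γ δ m =
      (∏ k : Fin N, Real.Gamma (γ (k + 1) + N - (k : ℕ)))⁻¹ * recWeight N γ (recOfMom m) := by
  rw [halfLineDensity, prod_Icc_one, prod_Icc_one, ← Finset.prod_inv_distrib]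
  have hmem : ∀ i : Fin N, (i : ℕ) + 1 ∈ Finset.Icc 1 N := fun i =>
    Finset.mem_Icc.2 ⟨by omega, i.2⟩
  congr 1
  · refine Finset.prod_congr rfl fun i _ => ?_
    rw [hδ _ (hmem i), Real.one_rpow, one_div]
    congr 2
    push_cast; ring
  · refine Finset.prod_congr rfl fun i _ => ?_
    rw [hδ _ (hmem i), if_pos (hm _ (hmem i)), one_mul, mul_one]
    rfl

theorem halfLineDensity_of_notMem {N : ℕ} (γ δ : ℕ → ℝ) {m : Fin N → ℝ} (hm : m ∉ posRegion N) :
    halfLineDensity N γ δ m = 0 := by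
  simp only [posRegion, Set.mem_ofPred_eq, not_forall] at hm
  obtain ⟨k, hk, hlt⟩ := hm
  refine mul_eq_zero_of_right _ (Finset.prod_eq_zero hk ?_)
  rw [if_neg hlt, mul_zero]

theorem measurableSet_posRegion (N : ℕ) : MeasurableSet (posRegion N) := by
  rw [← image_momOfRec]
  exact (measurableSet_pos N).image_of_continuousOn_injOn
    (differentiable_momOfRec N).continuous.continuousOn (injOn_momOfRec N)

/-- The lower bounds are infima over sets of measures, so measurability is not visible from the
definition. On the region the density is a measurable function of z transported along the measurable
embedding z ↦ m, extended by zero. -/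
theorem measurable_halfLineDensity {N : ℕ} {γ δ : ℕ → ℝ} (hδ : ∀ k ∈ Finset.Icc 1 N, δ k = 1) :
    Measurable (halfLineDensity N γ δ) := by
  have hemb := (differentiable_momOfRec N).continuous.continuousOn.measurableEmbedding
    (measurableSet_pos N) (injOn_momOfRec N)
  have hW : Measurable (recWeight N γ) := by
    unfold recWeight
    fun_prop
  set W : {z : Fin N → ℝ | ∀ i, 0 < z i} → ℝ := fun z =>
    (∏ k : Fin N, Real.Gamma (γ (k + 1) + N - (k : ℕ)))⁻¹ * recWeight N γ z
  have h := hemb.measurable_extend (g := W) ((hW.comp measurable_subtype_coe).const_mul _)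
    (measurable_const (a := (0 : ℝ)))
  convert h using 1
  funext m
  by_cases hm : m ∈ posRegion N
  · rw [halfLineDensity_of_mem hδ hm]
    rw [← image_momOfRec] at hm
    obtain ⟨z, hz, rfl⟩ := hm
    rw [recOfMom_momOfRec hz]
    exact (hemb.injective.extend_apply W (fun _ => 0) ⟨z, hz⟩).symm
  · rw [halfLineDensity_of_notMem γ δ hm, Function.extend_apply']
    rintro ⟨z, rfl⟩
    rw [← image_momOfRec] at hm
    exact hm ⟨z, z.2, rfl⟩

/-! ### Measurability -/

theorem measurable_mom (k : ℕ) : Measurable fun ν : Measure ℝ => mom ν k := by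
  classical
  have hp : Measurable fun ν : Measure ℝ => ∫⁻ x, ENNReal.ofReal (x ^ k) ∂ν :=
    Measure.measurable_lintegral (by fun_prop)
  have hn : Measurable fun ν : Measure ℝ => ∫⁻ x, ENNReal.ofReal (-x ^ k) ∂ν :=
    Measure.measurable_lintegral (by fun_prop)
  have hs : MeasurableSet {ν : Measure ℝ | ∫⁻ x, ‖x ^ k‖ₑ ∂ν < ∞} :=
    measurableSet_lt (Measure.measurable_lintegral (by fun_prop)) measurable_const
  -- The Bochner integral is 0 by default for nonintegrable powers, hence the case distinction on a
  -- measurable set of ν.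
  have h : (fun ν : Measure ℝ => mom ν k) = fun ν => if ∫⁻ x, ‖x ^ k‖ₑ ∂ν < ∞ then
      (∫⁻ x, ENNReal.ofReal (x ^ k) ∂ν).toReal - (∫⁻ x, ENNReal.ofReal (-x ^ k) ∂ν).toReal
      else 0 := by
    funext ν
    have hm : AEStronglyMeasurable (fun x : ℝ => x ^ k) ν := by fun_prop
    split_ifs with hi
    · exact integral_eq_lintegral_pos_part_sub_lintegral_neg_part ⟨hm, hi⟩
    · exact integral_undef fun hi' => hi hi'.2
  rw [h]
  exact Measurable.ite hs (hp.ennreal_toReal.sub hn.ennreal_toReal) measurable_const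

theorem measurable_momVec (N : ℕ) : Measurable (momVec N) :=
  measurable_pi_lambda _ fun _ => measurable_mom _

theorem measurableSet_probMoments {T : Set ℝ} (hT : MeasurableSet T) :
    MeasurableSet (probMoments T) := by
  have h : probMoments T = {ν | ν Set.univ = 1} ∩ ({ν | ν Tᶜ = 0} ∩
      ⋂ k : ℕ, {ν | ∫⁻ x, ‖x ^ k‖ₑ ∂ν < ∞}) := by
    ext ν
    simp only [probMoments, Set.mem_ofPred_eq, Set.mem_inter_iff, Set.mem_iInter]
    refine and_congr ⟨fun h => h.measure_univ, fun h => ⟨h⟩⟩ (and_congr_right fun _ =>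
      forall_congr' fun k => ⟨fun h => h.2, fun h => ⟨by fun_prop, h⟩⟩)
  rw [h]
  refine ((Measure.measurable_coe MeasurableSet.univ) (measurableSet_singleton _)).inter
    (((Measure.measurable_coe hT.compl) (measurableSet_singleton _)).inter
      (MeasurableSet.iInter fun k => ?_))
  exact measurableSet_lt (Measure.measurable_lintegral (by fun_prop)) measurable_const

theorem measurable_laguerreWeight (n : ℕ) (β g : ℝ) : Measurable (laguerreWeight n β g) := by
  unfold laguerreWeight
  refine Measurable.mul (by fun_prop) (Finset.measurable_prod _ fun i _ => ?_)
  refine Measurable.mul (by fun_prop) (Measurable.ite ?_ measurable_const measurable_const)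
  exact measurableSet_lt measurable_const (measurable_pi_apply i)

theorem laguerreWeight_nonneg {n : ℕ} {β g : ℝ} (x : Fin n → ℝ) :
    0 ≤ laguerreWeight n β g x := by
  refine mul_nonneg (by positivity) (Finset.prod_nonneg fun i _ => ?_)
  split_ifs with h
  · positivity
  · simp

theorem measurable_dirichletDensity_weightOf (r : ℕ) {β : ℝ} (hβ : 0 < β) :
    Measurable fun p : Fin r → ℝ =>
      ENNReal.ofReal (dirichletDensity (r + 1) β (weightOf p)) := by
  simp only [ofReal_dirichletDensity hβ]
  fun_prop

theorem completeWeights_succ (r : ℕ) (p : Fin r → ℝ) :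
    completeWeights (r + 1) p = weightOf p := by
  funext i
  refine Fin.lastCases ?_ (fun i => ?_) i
  · simp [completeWeights]
  · simp [completeWeights]

theorem dirichletLaw_succ (r : ℕ) (β : ℝ) : dirichletLaw (r + 1) β =
    ((volume : Measure (Fin r → ℝ)).withDensity fun p =>
      ENNReal.ofReal (dirichletDensity (r + 1) β (weightOf p))).map weightOf := by
  have h : (completeWeights (r + 1) : (Fin r → ℝ) → _) = weightOf :=
    funext (completeWeights_succ r)
  rw [← h]
  rfl

/-! ### The law of the moment vector -/

theorem map_momVec_laguerreSpectralLaw_apply {r N : ℕ} {β : ℝ} (hβ : 0 < β) (g : ℝ)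
    {S : Set (Fin N → ℝ)} (hS : MeasurableSet S) :
    (laguerreSpectralLaw (r + 1) β g).map (momVec N) S =
      ENNReal.ofReal (∫ y, laguerreWeight (r + 1) β g y)⁻¹ *
      ∫⁻ q : (Fin (r + 1) → ℝ) × (Fin r → ℝ), ENNReal.ofReal (laguerreWeight (r + 1) β g q.1) *
        ENNReal.ofReal (dirichletDensity (r + 1) β (weightOf q.2)) *
        S.indicator 1 (momVec N (atomicMeasure (r + 1) (q.1, weightOf q.2))) := by
  have hI : 0 ≤ (∫ y, laguerreWeight (r + 1) β g y)⁻¹ :=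
    inv_nonneg.2 (integral_nonneg fun y => laguerreWeight_nonneg y)
  have hL := measurable_laguerreWeight (r + 1) β g
  have hD := measurable_dirichletDensity_weightOf r hβ
  have hw := measurable_weightOf r
  have hΘ : Measurable fun q : (Fin (r + 1) → ℝ) × (Fin r → ℝ) =>
      momVec N (atomicMeasure (r + 1) (q.1, weightOf q.2)) :=
    (measurable_momVec N).comp ((measurable_atomicMeasure _).comp
      (measurable_fst.prodMk (hw.comp measurable_snd)))
  have hlaw : (laguerreSpectralLaw (r + 1) β g).map (momVec N) =
      ((volume : Measure ((Fin (r + 1) → ℝ) × (Fin r → ℝ))).withDensity fun q =>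
        ENNReal.ofReal ((∫ y, laguerreWeight (r + 1) β g y)⁻¹ * laguerreWeight (r + 1) β g q.1) *
        ENNReal.ofReal (dirichletDensity (r + 1) β (weightOf q.2))).map
          fun q => momVec N (atomicMeasure (r + 1) (q.1, weightOf q.2)) := by
    rw [laguerreSpectralLaw, dirichletLaw_succ, laguerreEigenLaw,
      Measure.map_map (measurable_momVec N) (measurable_atomicMeasure _)]
    conv_lhs => rw [← Measure.map_id (μ := Measure.withDensity _ fun x => ENNReal.ofReal
      ((∫ y, laguerreWeight (r + 1) β g y)⁻¹ * laguerreWeight (r + 1) β g x))]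
    rw [Measure.map_prod_map _ _ measurable_id hw,
      Measure.map_map ((measurable_momVec N).comp (measurable_atomicMeasure _))
        (measurable_id.prodMap hw), prod_withDensity (by fun_prop) hD]
    rfl
  rw [hlaw, Measure.map_apply hΘ hS, withDensity_apply _ (hΘ hS),
    ← lintegral_indicator (hΘ hS), ← lintegral_const_mul' _ _ ENNReal.ofReal_ne_top]
  refine lintegral_congr fun q => ?_
  by_cases hq : momVec N (atomicMeasure (r + 1) (q.1, weightOf q.2)) ∈ S
  · rw [Set.indicator_of_mem (by exact hq), Set.indicator_of_mem hq, ENNReal.ofReal_mul hI]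
    simp [mul_assoc]
  · rw [Set.indicator_of_notMem (by exact hq), Set.indicator_of_notMem hq]
    simp

theorem map_momVec_laguerreSpectralLaw {r N : ℕ} (hN : N = 2 * r + 1) {β : ℝ} (hβ : 0 < β)
    {g : ℝ} (hg : -1 < g) {γ δ : ℕ → ℝ} (hδ : ∀ k ∈ Finset.Icc 1 N, δ k = 1)
    (hγ : ∀ j < N, γ (j + 1) = (β / 2 - 2) * ((r : ℝ) - (j / 2 : ℕ)) + if Even j then g else 0) :
    (laguerreSpectralLaw (r + 1) β g).map (momVec N) =
      volume.withDensity fun m => ENNReal.ofReal (halfLineDensity N γ δ m) := by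
  let e : Fin r ⊕ Fin (r + 1) ≃ Fin N := finSumFinEquiv.trans (finCongr (by omega))
  -- Substituting γ, the Gamma argument at k = 2i is (β/2)(r - i) + g + 1, and at k = 2i + 1 it is
  -- (β/2)(r - i) with i < r.
  have hγpos : ∀ k : Fin N, 0 < γ (k + 1) + N - (k : ℕ) := by
    intro k
    have hN' : (N : ℝ) = 2 * r + 1 := by rw [hN]; push_cast; ring
    have hk := k.2
    rw [hγ k k.2, hN']
    obtain ⟨i, hi | hi⟩ := (k : ℕ).even_or_odd'
    · have hir : (i : ℝ) ≤ r := by exact_mod_cast (by omega : i ≤ r)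
      have : 0 ≤ β * (r - i) := mul_nonneg hβ.le (by linarith)
      rw [hi, if_pos (by simp), Nat.mul_div_cancel_left _ two_pos]
      push_cast
      linarith
    · have hir : (i : ℝ) < r := by exact_mod_cast (by omega : i < r)
      have : 0 < β * (r - i) := mul_pos hβ (by linarith)
      rw [hi, if_neg (by simp), show (2 * i + 1) / 2 = i by omega]
      push_cast
      linarith
  set A := ∏ k : Fin N, Real.Gamma (γ (k + 1) + N - (k : ℕ)) with hA
  have hA0 : 0 < A := Finset.prod_pos fun k _ => Real.Gamma_pos_of_pos (hγpos k)
  set c := Real.Gamma (((r + 1 : ℕ) : ℝ) * β / 2) / Real.Gamma (β / 2) ^ (r + 1) with hc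
  have hc0 : 0 < c := div_pos (Real.Gamma_pos_of_pos (by positivity))
    (pow_pos (Real.Gamma_pos_of_pos (by positivity)) _)
  have hL := measurable_laguerreWeight (r + 1) β g
  have hmain := lintegral_nodes_weights hN e hβ g hγ
  rw [← hc] at hmain
  -- Taking φ = 1 in the main identity evaluates the eigenvalue normalization; indicator functions φ
  -- later give the law itself.
  have hmass : ∫⁻ x, ENNReal.ofReal (laguerreWeight (r + 1) β g x) =
      ENNReal.ofReal ((r + 1).factorial * (c * A)) := by
    have h1 := hmain fun _ => 1
    simp only [mul_one] at h1
    rw [Measure.volume_eq_prod, lintegral_prod_mul hL.ennreal_ofReal.aemeasurable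
      (measurable_dirichletDensity_weightOf r hβ).aemeasurable, lintegral_dirichletDensity hβ,
      mul_one, lintegral_const_mul' _ _ ENNReal.ofReal_ne_top, lintegral_recWeight hγpos] at h1
    rw [h1, ENNReal.ofReal_mul (by positivity), ENNReal.ofReal_mul hc0.le, ENNReal.ofReal_natCast]
  have hint : ∫ x, laguerreWeight (r + 1) β g x = (r + 1).factorial * (c * A) := by
    rw [integral_eq_lintegral_of_nonneg_ae
      (Filter.Eventually.of_forall fun x => laguerreWeight_nonneg x) hL.aestronglyMeasurable,
      hmass, ENNReal.toReal_ofReal (by positivity)]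
  have hconst : ENNReal.ofReal ((r + 1).factorial * (c * A))⁻¹ *
      (((r + 1).factorial : ℝ≥0∞) * ENNReal.ofReal c) = ENNReal.ofReal A⁻¹ := by
    rw [← ENNReal.ofReal_natCast, ← ENNReal.ofReal_mul (by positivity),
      ← ENNReal.ofReal_mul (by positivity)]
    congr 1
    have : ((r + 1).factorial : ℝ) ≠ 0 := by positivity
    field_simp
  refine Measure.ext fun S hS => ?_
  rw [map_momVec_laguerreSpectralLaw_apply hβ g hS, hmain, hint,
    lintegral_const_mul' _ _ ENNReal.ofReal_ne_top, ← mul_assoc, ← mul_assoc,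
    mul_assoc (ENNReal.ofReal _), hconst, ← lintegral_const_mul' _ _ ENNReal.ofReal_ne_top,
    withDensity_apply _ hS, ← lintegral_indicator (measurableSet_posRegion N),
    ← lintegral_indicator hS]
  refine lintegral_congr fun m => ?_
  classical
  by_cases hm : m ∈ posRegion N
  · rw [Set.indicator_of_mem hm]
    by_cases hmS : m ∈ S
    · rw [Set.indicator_of_mem hmS, Set.indicator_of_mem hmS, halfLineDensity_of_mem hδ hm,
        ENNReal.ofReal_mul (by positivity)]
      simp
      rw [hA]
    · rw [Set.indicator_of_notMem hmS, Set.indicator_of_notMem hmS]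
      simp
  · rw [Set.indicator_of_notMem hm, Set.indicator_apply]
    simp [halfLineDensity_of_notMem γ δ hm]

theorem ae_laguerreSpectralLaw_mem {n : ℕ} {β g : ℝ} (hβ : 0 < β) :
    ∀ᵐ ν ∂(laguerreSpectralLaw (n + 1) β g), ν ∈ probMoments (Set.Ici 0) := by
  have hw := measurable_weightOf n
  have hs : MeasurableSet (simplex (n + 1)) := by
    simp only [simplex, Set.ofPred_and, Set.ofPred_forall]
    exact (MeasurableSet.iInter fun i =>
      measurableSet_lt measurable_const (measurable_pi_apply i)).inter
      (measurableSet_eq_fun (by fun_prop) measurable_const)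
  have h1 : ∀ᵐ x ∂(laguerreEigenLaw (n + 1) β g), ∀ i, 0 < x i := by
    have := measurable_laguerreWeight (n + 1) β g
    rw [laguerreEigenLaw, ae_withDensity_iff (by fun_prop)]
    refine Filter.Eventually.of_forall fun x hx => ?_
    by_contra h
    exact hx (by rw [laguerreWeight_eq_zero hβ g fun h' => h h'.2]; simp)
  have h2 : ∀ᵐ w ∂(dirichletLaw (n + 1) β), w ∈ simplex (n + 1) := by
    rw [dirichletLaw_succ, ae_map_iff (p := (· ∈ simplex (n + 1))) hw.aemeasurable hs,
      ae_withDensity_iff (measurable_dirichletDensity_weightOf n hβ)]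
    refine Filter.Eventually.of_forall fun p hp => ?_
    by_contra h
    exact hp (by rw [dirichletDensity, if_neg h]; simp)
  rw [laguerreSpectralLaw, ae_map_iff (p := (· ∈ probMoments (Set.Ici 0))) (measurable_atomicMeasure _).aemeasurable
    (measurableSet_probMoments measurableSet_Ici)]
  have : SFinite (dirichletLaw (n + 1) β) := by rw [dirichletLaw_succ]; infer_instance
  filter_upwards [Measure.quasiMeasurePreserving_fst.ae h1,
    Measure.quasiMeasurePreserving_snd.ae h2] with q hq1 hq2
  exact atomicMeasure_mem_probMoments (x := q.1) (w := q.2) (fun i => (hq1 i).le)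
    (fun i => (hq2.1 i).le) hq2.2

/-! ### The main theorem -/

theorem mainTheorem10 {Ω : Type*} [MeasurableSpace Ω] (P : Measure Ω)
    (n : ℕ) (hn : 1 ≤ n) (β : ℝ) (hβ : 0 < β) (γ₀ : ℝ) (hγ₀ : -1 < γ₀)
    (μ : Ω → Measure ℝ) (hμ : HasLaw μ (laguerreSpectralLaw n β γ₀) P)
    (γ δ : ℕ → ℝ)
    (hδ : ∀ k ∈ Finset.Icc 1 (2 * n - 1), δ k = 1)
    (hγ_odd : ∀ k ∈ Finset.Icc 1 n,
      γ (2 * k - 1) = (β / 2 - 2) * ((n : ℝ) - (k : ℝ)) + γ₀)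
    (hγ_even : ∀ k ∈ Finset.Icc 1 (n - 1),
      γ (2 * k) = (β / 2 - 2) * ((n : ℝ) - (k : ℝ))) :
    (∀ᵐ ω ∂P, μ ω ∈ probMoments (Set.Ici 0) ∧
      momVec (2 * n - 1) (μ ω) ∈ momentSpace (2 * n - 1) (Set.Ici 0)) ∧
    HasPDF (fun ω => momVec (2 * n - 1) (μ ω)) P volume ∧
    pdf (fun ω => momVec (2 * n - 1) (μ ω)) P volume =ᵐ[volume]
      fun m => ENNReal.ofReal (halfLineDensity (2 * n - 1) γ δ m) := by
  obtain ⟨r, rfl⟩ : ∃ r, n = r + 1 := ⟨n - 1, by omega⟩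
  have hN : 2 * (r + 1) - 1 = 2 * r + 1 := by omega
  -- Both families of exponents in one zero-based formula: j = 2i and j = 2i + 1 correspond to k = i
  -- + 1, for which n - k = r - i.
  have hγ : ∀ j < 2 * (r + 1) - 1, γ (j + 1) =
      (β / 2 - 2) * ((r : ℝ) - (j / 2 : ℕ)) + if Even j then γ₀ else 0 := by
    intro j hj
    obtain ⟨i, rfl | rfl⟩ := j.even_or_odd'
    · have h := hγ_odd (i + 1) (Finset.mem_Icc.2 ⟨by omega, by omega⟩)
      rw [show 2 * (i + 1) - 1 = 2 * i + 1 by omega] at h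
      rw [h, if_pos (by simp), Nat.mul_div_cancel_left _ two_pos]
      push_cast; ring
    · have h := hγ_even (i + 1) (Finset.mem_Icc.2 ⟨by omega, by omega⟩)
      rw [show 2 * i + 1 + 1 = 2 * (i + 1) by ring, h, if_neg (by simp),
        show (2 * i + 1) / 2 = i by omega]
      push_cast; ring
  have hX : AEMeasurable (fun ω => momVec (2 * (r + 1) - 1) (μ ω)) P :=
    (measurable_momVec _).comp_aemeasurable hμ.aemeasurable
  have hf : AEMeasurable (fun m => ENNReal.ofReal (halfLineDensity (2 * (r + 1) - 1) γ δ m)) :=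
    (measurable_halfLineDensity hδ).ennreal_ofReal.aemeasurable
  have hmap : P.map (fun ω => momVec (2 * (r + 1) - 1) (μ ω)) =
      volume.withDensity fun m => ENNReal.ofReal (halfLineDensity (2 * (r + 1) - 1) γ δ m) := by
    rw [← map_momVec_laguerreSpectralLaw hN hβ hγ₀ hδ hγ, ← hμ.map_eq,
      AEMeasurable.map_map_of_aemeasurable (measurable_momVec _).aemeasurable hμ.aemeasurable]
    rfl
  have hpdf := hasPDF_of_map_eq_withDensity hX _ hf hmap
  refine ⟨?_, hpdf, (pdf.eq_of_map_eq_withDensity' _ hf).1 hmap⟩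
  have hae : ∀ᵐ ν ∂(P.map μ), ν ∈ probMoments (Set.Ici 0) := by
    rw [hμ.map_eq]; exact ae_laguerreSpectralLaw_mem hβ
  filter_upwards [ae_of_ae_map hμ.aemeasurable hae] with ω hω
  exact ⟨hω, _, hω, rfl⟩
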